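/- Let $n,s,k$ be integers with $n\ge 1$, $s\ge 3$ and $k\ge 3$. A *Berge path of length $k$* consists of $k$ distinct edges $e_1,\dots,e_k$ and $k+1$ distinct vertices $v_1,\dots,v_{k+1}$ with $v_i,v_{i+1}\in e_i$ for $1\le i\le k$; let $\mathcal B_k$ be the family of Berge paths of length $k$. Let $ar(n,s,\mathcal B_k)$ be the smallest positive integer $c$ such that every colouring of the edges of the complete $s$-uniform hypergraph on $n$ vertices with exactly $c$ colours contains a rainbow Berge path of length $k$, i.e. one whose $k$ edges have pairwise distinct colours. For all fixed $s\ge 3$ and $k\ge 3$ there is $n_0=n_0(s,k)$ such that for every $n\ge n_0$: - if $k>2s+1$, then $$\frac{2n}{k}\binom{\lfloor k/2\rfloor}{s}\le ar(n,s,\mathcal B_k)\le \frac{n}{k-1}\binom{k-1}{s}+1;$$ - if $s+2\le k\le 2s+1$, then $$\frac{n}{s+1}\left\lfloor\frac{k-2}{2}\right\rfloor\le ar(n,s,\mathcal B_k)\le \frac{n}{k-1}\binom{k-1}{s}+1;$$ - if $k\le s+1$, then $$\left\lfloor\frac{n}{s+1}\right\rfloor\left\lfloor\frac{k-2}{2}\right\rfloor\le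 ar(n,s,\mathcal B_k)\le \frac{(k-2)n}{s+1}+1.$$ -/

import Mathlib

namespace BergeAntiRamsey

/-- The edges of the complete `s`-uniform hypergraph on the vertex set `Fin n`:
all `s`-element sets of vertices. -/
abbrev Edge (n s : ℕ) : Type := {e : Finset (Fin n) // e.card = s}

/-- The family of Berge paths of length `k` in the complete `s`-uniform hypergraph on `n`
vertices, each one given by its set of edges: there are `k` distinct edges `e 0, …, e (k-1)` and
`k + 1` distinct vertices `v 0, …, v k` such that `e i` contains `v i` and `v (i+1)`. -/
def bergePaths (n s k : ℕ) : Set (Set (Edge n s)) :=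
  {P | ∃ (e : Fin k → Edge n s) (v : Fin (k + 1) → Fin n),
    Function.Injective e ∧ Function.Injective v ∧
    (∀ i : Fin k, v i.castSucc ∈ (e i).1 ∧ v i.succ ∈ (e i).1) ∧
    P = Set.range e}

/-- A set of edges is rainbow under an edge-colouring if its edges have distinct colours. -/
def IsRainbow {n s : ℕ} {C : Type*} (φ : Edge n s → C) (P : Set (Edge n s)) : Prop :=
  Set.InjOn φ P

/-- The positive integers `c` such that every colouring of the edges of the complete `s`-uniform
hypergraph on `n` vertices with exactly `c` colours has a rainbow member of the family `F`. -/
def forcingNumbers (n s : ℕ) (F : Set (Set (Edge n s))) : Set ℕ :=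
  {c | 1 ≤ c ∧ ∀ φ : Edge n s → Fin c, Function.Surjective φ → ∃ P ∈ F, IsRainbow φ P}

/-- The anti-Ramsey number of the family `F`: the smallest positive integer `c` such that every
edge-colouring with exactly `c` colours has a rainbow member of `F`. -/
noncomputable def antiRamsey (n s : ℕ) (F : Set (Set (Edge n s))) : ℕ :=
  sInf (forcingNumbers n s F)

/-- There is always such an integer, since there is no colouring with more colours than edges;
so the infimum in `antiRamsey` is a minimum. -/
theorem forcingNumbers_nonempty (n s : ℕ) (F : Set (Set (Edge n s))) :
    (forcingNumbers n s F).Nonempty := by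
  refine ⟨Fintype.card (Edge n s) + 1, by omega, fun φ hφ => ?_⟩
  have h := Fintype.card_le_of_surjective φ hφ
  rw [Fintype.card_fin] at h
  omega

/-- The minimum is attained. -/
theorem antiRamsey_mem (n s : ℕ) (F : Set (Set (Edge n s))) :
    antiRamsey n s F ∈ forcingNumbers n s F :=
  Nat.sInf_mem (forcingNumbers_nonempty n s F)

end BergeAntiRamsey

/-! Upper bounds. In a colouring without a rainbow Berge path of length k, let p + 2 ≤ k be the
least length that no rainbow path has, so some rainbow path has p + 1 edges. Let v be its first
vertex. Every edge through v with a vertex off this path repeats one of its p + 1 colours, since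
otherwise the path could be prolonged. Choose one edge of each other colour; they form a hypergraph
G whose size is the number of colours up to a constant.

If G has no Berge path of length p, a Turán-type bound gives |G| ≤ γn with γ below the claimed
coefficient (`exists_turan_rate`). If G has such a path, edges through v serve as connectors: they
can contain any two further vertices, and their colours do not occur in G. Attaching one connector
and a few edges of G to the path must not produce length p + 2. Up to O(1) exceptions, this forces
each edge of G to consist of one outside vertex and s - 1 vertices from a set of at most p/2 path
vertices (`card_le_of_walk`). Then |G| ≤ C(p/2, s - 1) n + O(1), again with a coefficient below the
claimed one. Large n absorbs the constants.

The Turán bound for p ≤ s is (p - 1)n/s, by depth-first search in the incidence graph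
(`depth_first`). For p > s, a red-blue decomposition turns the hypergraph into red edges and blue
s-cliques of a graph without long paths (`exists_red_blue`). These are counted by deleting vertices
of low degree and splitting off components spanned by a cycle (`weight_le`).

Lower bounds. If every Berge path of length k has two edges outside H, then distinct colours on H
and one colour elsewhere show that |H| is too few colours. The choices of H are the edges with
exactly one vertex outside a fixed small set, a sunflower, and disjoint blocks of s + 1 vertices. -/

namespace BergeAntiRamsey

/-! ### Alternating walks of vertices and edges -/

/-- `Walk I vs es`: the vertices `vs = [v₀, …, v_k]` and the edges `es = [e₁, …, e_k]` satisfy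
`I v_{i-1} e_i` and `I v_i e_i` for all `i`. -/
inductive Walk {V E : Type*} (I : V → E → Prop) : List V → List E → Prop
  | single (v : V) : Walk I [v] []
  | cons {v u : V} {vs : List V} {e : E} {es : List E} (hv : I v e) (hu : I u e)
      (h : Walk I (u :: vs) es) : Walk I (v :: u :: vs) (e :: es)

namespace Walk

variable {V E : Type*} {I : V → E → Prop}

theorem length_eq {vs : List V} {es : List E} (h : Walk I vs es) :
    vs.length = es.length + 1 := by
  induction h with
  | single => rfl
  | cons _ _ _ ih => simpa using ih

/-- Two walks are joined by an edge. -/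
theorem append {l l' : List V} {m m' : List E} {a b : V} {e : E}
    (h : Walk I (l ++ [a]) m) (h' : Walk I (b :: l') m') (ha : I a e) (hb : I b e) :
    Walk I (l ++ a :: b :: l') (m ++ e :: m') := by
  induction l generalizing m with
  | nil =>
    cases h with
    | single => exact .cons ha hb h'
  | cons c l ih =>
    cases l with
    | nil =>
      cases h with
      | cons h1 h2 h3 => exact .cons h1 h2 (ih h3)
    | cons d l =>
      cases h with
      | cons h1 h2 h3 => exact .cons h1 h2 (ih h3)

theorem reverse {vs : List V} {es : List E} (h : Walk I vs es) :
    Walk I vs.reverse es.reverse := by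
  induction h with
  | single v => exact .single v
  | @cons v u vs e es hv hu h ih =>
    have := append (l := vs.reverse) (a := u) (b := v) (l' := []) (m := es.reverse) (m' := [])
      (e := e) (by simpa using ih) (.single v) hu hv
    simpa using this

/-- A walk is cut at one of its edges. -/
theorem split {l l' : List V} {m : List E} {a b : V} (h : Walk I (l ++ a :: b :: l') m) :
    ∃ m₁ e m₂, m = m₁ ++ e :: m₂ ∧ Walk I (l ++ [a]) m₁ ∧ Walk I (b :: l') m₂ := by
  induction l generalizing m with
  | nil =>
    cases h with
    | @cons _ _ _ e es h1 h2 h3 => exact ⟨[], e, es, rfl, .single a, h3⟩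
  | cons c l ih =>
    cases l with
    | nil =>
      cases h with
      | @cons _ _ _ e es h1 h2 h3 =>
        obtain ⟨m₁, f, m₂, rfl, h4, h5⟩ := ih h3
        exact ⟨e :: m₁, f, m₂, rfl, .cons h1 h2 h4, h5⟩
    | cons d l =>
      cases h with
      | @cons _ _ _ e es h1 h2 h3 =>
        obtain ⟨m₁, f, m₂, rfl, h4, h5⟩ := ih h3
        exact ⟨e :: m₁, f, m₂, rfl, .cons h1 h2 h4, h5⟩

theorem incident {vs : List V} {es : List E} (h : Walk I vs es) (i : ℕ) (hi : i < es.length) :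
    I (vs[i]'(by have := h.length_eq; omega)) es[i] ∧
      I (vs[i + 1]'(by have := h.length_eq; omega)) es[i] := by
  induction h generalizing i with
  | single => simp at hi
  | cons hv hu h ih =>
    cases i with
    | zero => exact ⟨hv, hu⟩
    | succ i => exact ih i (by simpa using hi)

/-- A walk that alternates between edges and vertices, with edges at both ends, is completed to
one with vertices at both ends. -/
theorem of_flip {es : List E} {ys : List V} (h : Walk (flip I) es ys) {a b : V}
    (ha : ∀ x ∈ es.head?, I a x) (hb : ∀ x ∈ es.getLast?, I b x) :
    Walk I (a :: (ys ++ [b])) es := by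
  induction h generalizing a with
  | single x => exact .cons (ha x rfl) (hb x rfl) (.single b)
  | @cons x x' es y ys hx hx' h ih =>
    refine .cons (ha x rfl) hx (ih ?_ ?_)
    · simp only [List.head?_cons, Option.mem_def, Option.some.injEq, forall_eq']
      exact hx'
    · intro z hz
      exact hb z (by simpa using hz)

end Walk

/-! ### Turán bound for paths of length at most s, by depth-first search -/

/-- The hypergraph with edges `H`, where `N e` is the vertex set of `e`, has a Berge path with
`k` edges. -/
def HasPath {V E : Type*} (N : E → Finset V) (H : Finset E) (k : ℕ) : Prop :=
  ∃ (vs : List V) (es : List E), Walk (fun v e => v ∈ N e) vs es ∧ vs.Nodup ∧ es.Nodup ∧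
    es.length = k ∧ ∀ e ∈ es, e ∈ H

section DepthFirst

variable {V E : Type*} [DecidableEq V] {N : E → Finset V} {H : Finset E}
  {s p : ℕ}

/-- The p - 1 inner vertices cannot fill an edge, because p ≤ s, so both end edges have a free
vertex. If these could not be chosen distinct, both end edges would equal the inner vertices plus
one common vertex. Injectivity of `N` excludes this for p ≥ 2, and s ≥ 2 excludes it for p = 1. -/
theorem hasPath_of_flip_walk (hN : ∀ e ∈ H, (N e).card = s) (hinj : Set.InjOn N H) (hs : 2 ≤ s)
    (hps : p ≤ s) (hp : 1 ≤ p) {es : List E} {ys : List V}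
    (h : Walk (flip fun v e => v ∈ N e) es ys) (hes : es.Nodup) (hys : ys.Nodup)
    (hH : ∀ e ∈ es, e ∈ H) (hlen : es.length = p) : HasPath N H p := by
  have hyl := h.length_eq
  have hne : es ≠ [] := by rintro rfl; simp at hlen; omega
  set x := es.head hne with hx
  set z := es.getLast hne with hz
  have hxH : x ∈ H := hH _ (List.head_mem hne)
  have hzH : z ∈ H := hH _ (List.getLast_mem hne)
  have hcard : ys.toFinset.card ≤ p - 1 := (List.toFinset_card_le ys).trans (by omega)
  obtain ⟨a, ha, b, hb, hab⟩ : ∃ a ∈ N x \ ys.toFinset, ∃ b ∈ N z \ ys.toFinset, a ≠ b := by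
    by_contra! hcon
    have h1 : (N x \ ys.toFinset).Nonempty := by
      rw [← Finset.card_pos]
      have := Finset.le_card_sdiff ys.toFinset (N x)
      rw [hN x hxH] at this
      omega
    have h2 : (N z \ ys.toFinset).Nonempty := by
      rw [← Finset.card_pos]
      have := Finset.le_card_sdiff ys.toFinset (N z)
      rw [hN z hzH] at this
      omega
    obtain ⟨a, ha⟩ := h1
    obtain ⟨b, hb⟩ := h2
    have hsub1 : N x ⊆ insert b ys.toFinset := by
      intro u hu
      by_cases huy : u ∈ ys.toFinset
      · exact Finset.mem_insert_of_mem huy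
      · rw [hcon u (Finset.mem_sdiff.2 ⟨hu, huy⟩) b hb]
        exact Finset.mem_insert_self _ _
    have hsub2 : N z ⊆ insert b ys.toFinset := by
      intro u hu
      by_cases huy : u ∈ ys.toFinset
      · exact Finset.mem_insert_of_mem huy
      · rw [← hcon a ha u (Finset.mem_sdiff.2 ⟨hu, huy⟩), hcon a ha b hb]
        exact Finset.mem_insert_self _ _
    have hc : (insert b ys.toFinset).card ≤ p := (Finset.card_insert_le _ _).trans (by omega)
    have e1 := Finset.eq_of_subset_of_card_le hsub1 (by rw [hN x hxH]; omega)
    have e2 := Finset.eq_of_subset_of_card_le hsub2 (by rw [hN z hzH]; omega)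
    have hxz : x = z := hinj hxH hzH (e1.trans e2.symm)
    have hp1 : p = 1 := by
      by_contra hp1
      rw [hx, hz, List.head_eq_getElem, List.getLast_eq_getElem, hes.getElem_inj_iff] at hxz
      omega
    have := Finset.card_le_card hsub1
    rw [hN x hxH] at this
    omega
  rw [Finset.mem_sdiff, List.mem_toFinset] at ha hb
  refine ⟨_, _, h.of_flip (a := a) (b := b) ?_ ?_, ?_, hes, hlen, hH⟩
  · intro e he
    rw [List.head?_eq_some_head hne] at he
    cases he
    exact ha.1
  · intro e he
    rw [List.getLast?_eq_some_getLast hne] at he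
    cases he
    exact hb.1
  · rw [List.nodup_cons, List.nodup_append]
    simp only [List.mem_append, List.mem_singleton, not_or, List.nodup_singleton]
    exact ⟨⟨ha.2, hab⟩, hys, trivial, fun u hu v hv => by rintro rfl; exact hb.2 (hv ▸ hu)⟩

variable [DecidableEq E]

/-- Passes from depth d + 1 to depth d of the search, with a = p - d - 1 and b = s - d. After
multiplication by b - 1 the slack is exactly (m - b)(b - a). -/
theorem exploration_bound {a b m t : ℤ} (hb : 2 ≤ b) (hab : a ≤ b) (hm : b ≤ m)
    (h : t * (b - 1) + (a - 1) ≤ (a - 1) * m) : (t + 1) * b ≤ a * m := by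
  have h1 : (b - 1) * ((t + 1) * b) ≤ (b - 1) * (a * m) := by
    nlinarith [mul_nonneg (sub_nonneg.2 hm) (sub_nonneg.2 hab)]
  exact le_of_mul_le_mul_left h1 (by omega)

/-- Depth-first exploration of the incidence graph. The list `es` holds the edges and `ys` the
vertices on the current branch, `X` the edges and `A` the vertices not yet reached. -/
theorem depth_first (hN : ∀ e ∈ H, (N e).card = s) (hinj : Set.InjOn N H) (hs : 2 ≤ s)
    (hps : p ≤ s) (hp : 1 ≤ p) (hno : ¬ HasPath N H p) (M : ℕ) :
    (∀ (x : E) (es : List E) (ys : List V) (X : Finset E) (A : Finset V),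
      X.card + A.card ≤ M →
      Walk (flip fun v e => v ∈ N e) (x :: es) ys → (x :: es).Nodup → ys.Nodup →
      (∀ e ∈ x :: es, e ∈ H) → X ⊆ H → (∀ e ∈ x :: es, e ∉ X) → (∀ y ∈ ys, y ∉ A) →
      (x :: es).length < p →
      (∀ e ∈ X, N e ⊆ A ∪ ys.toFinset) →
      ∃ X' ⊆ X, ∃ A' ⊆ A, N x ∩ A ⊆ A' ∧ (∀ e ∈ X \ X', N e ⊆ (A \ A') ∪ ys.toFinset) ∧
        (A' = ∅ ∧ X' = ∅ ∨ (X'.card : ℤ) * (s - (x :: es).length) + (p - (x :: es).length - 1)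
          ≤ (p - (x :: es).length - 1) * A'.card)) ∧
    (∀ (x : E) (es : List E) (y : V) (ys : List V) (X : Finset E) (A : Finset V),
      X.card + A.card ≤ M →
      Walk (flip fun v e => v ∈ N e) (x :: es) ys → (x :: es).Nodup → (y :: ys).Nodup →
      (∀ e ∈ x :: es, e ∈ H) → X ⊆ H → (∀ e ∈ x :: es, e ∉ X) → (∀ z ∈ y :: ys, z ∉ A) →
      (x :: es).length < p → y ∈ N x →
      (∀ e ∈ X, N e ⊆ A ∪ (y :: ys).toFinset) →
      ∃ X' ⊆ X, ∃ A' ⊆ A, (∀ e ∈ X \ X', N e ⊆ (A \ A') ∪ ys.toFinset) ∧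
        (X'.card : ℤ) * (s - (x :: es).length) ≤ (p - (x :: es).length - 1) * A'.card) := by
  -- `X'` and `A'` are the edges and vertices that the search reaches, and the first part explores
  -- from an edge `x`, the second from a vertex `y` of `x` already removed from `A`. With d edges on
  -- the branch, a reached edge costs s - d and a reached vertex pays p - d - 1. A vertex at which
  -- the search continues from `x` is counted only in the first part, which leaves its surplus p - d
  -- - 1.
  induction M using Nat.strong_induction_on with
  | _ M ih =>
  constructor
  · intro x es ys X A hM hw hes hys hH hX hXes hA hlen hsub
    by_cases hne : (N x ∩ A).Nonempty
    swap
    · rw [Finset.not_nonempty_iff_eq_empty] at hne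
      exact ⟨∅, by simp, ∅, by simp, by simp [hne], by simpa using hsub, Or.inl ⟨rfl, rfl⟩⟩
    obtain ⟨y, hy⟩ := hne
    rw [Finset.mem_inter] at hy
    have hAcard : (A.erase y).card + 1 = A.card := Finset.card_erase_add_one hy.2
    have hyys : y ∉ ys := fun h => hA y h hy.2
    obtain ⟨X₁, hX₁, A₁, hA₁, hsub₁, hb₁⟩ := (ih (X.card + (A.erase y).card) (by omega)).2
      x es y ys X (A.erase y) le_rfl hw hes (List.nodup_cons.2 ⟨hyys, hys⟩) hH hX hXes
      (by
        intro z hz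
        rcases List.mem_cons.1 hz with rfl | hz
        · simp
        · exact fun h => hA z hz (Finset.mem_of_mem_erase h)) hlen hy.1
      (by
        intro e he u hu
        have := hsub e he hu
        simp only [Finset.mem_union, List.mem_toFinset, Finset.mem_erase, List.mem_cons] at this ⊢
        by_cases huy : u = y <;> tauto)
    have hc1 := Finset.card_le_card hX₁
    have hc2 := Finset.card_le_card hA₁
    have hc3 : (X \ X₁).card + X₁.card = X.card := Finset.card_sdiff_add_card_eq_card hX₁
    have hc4 : (A.erase y \ A₁).card + A₁.card = (A.erase y).card :=
      Finset.card_sdiff_add_card_eq_card hA₁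
    obtain ⟨X₂, hX₂, A₂, hA₂, hN₂, hsub₂, hb₂⟩ :=
      (ih ((X \ X₁).card + (A.erase y \ A₁).card) (by omega)).1
      x es ys (X \ X₁) (A.erase y \ A₁) le_rfl hw hes hys hH
      (Finset.sdiff_subset.trans hX) (fun e he h => hXes e he (Finset.mem_sdiff.1 h).1)
      (fun z hz h => hA z hz (Finset.mem_of_mem_erase (Finset.mem_sdiff.1 h).1)) hlen hsub₁
    have hyA₁ : y ∉ A₁ := fun h => by simpa using hA₁ h
    have hyA₂ : y ∉ A₂ := fun h => by simpa using hA₂ h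
    have hdX : Disjoint X₁ X₂ := (Finset.disjoint_sdiff).mono_right hX₂
    have hdA : Disjoint A₁ A₂ := (Finset.disjoint_sdiff).mono_right hA₂
    have hcX : (X₁ ∪ X₂).card = X₁.card + X₂.card := Finset.card_union_of_disjoint hdX
    have hcA : (insert y (A₁ ∪ A₂)).card = A₁.card + A₂.card + 1 := by
      rw [Finset.card_insert_of_notMem (by simp [hyA₁, hyA₂]), Finset.card_union_of_disjoint hdA]
    refine ⟨X₁ ∪ X₂, Finset.union_subset hX₁ (hX₂.trans Finset.sdiff_subset),
      insert y (A₁ ∪ A₂), ?_, ?_, ?_, Or.inr ?_⟩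
    · refine Finset.insert_subset hy.2 (Finset.union_subset ?_ ?_)
      · exact hA₁.trans (Finset.erase_subset _ _)
      · exact (hA₂.trans Finset.sdiff_subset).trans (Finset.erase_subset _ _)
    · intro u hu
      rw [Finset.mem_inter] at hu
      by_cases h1 : u = y
      · simp [h1]
      by_cases h2 : u ∈ A₁
      · simp [h2]
      have := hN₂ (Finset.mem_inter.2 ⟨hu.1, Finset.mem_sdiff.2
        ⟨Finset.mem_erase.2 ⟨h1, hu.2⟩, h2⟩⟩)
      simp [this]
    · intro e he u hu
      have := hsub₂ e (by
        simp only [Finset.mem_sdiff, Finset.mem_union] at he ⊢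
        tauto) hu
      simp only [Finset.mem_sdiff, Finset.mem_union, Finset.mem_insert, Finset.mem_erase] at this ⊢
      tauto
    · rw [hcX, hcA]
      rcases hb₂ with ⟨rfl, rfl⟩ | hb₂
      · simp only [Finset.card_empty]
        push_cast at hb₁ ⊢
        linarith
      · push_cast
        have : (0 : ℤ) ≤ p - (x :: es).length - 1 := by omega
        nlinarith
  · intro x es y ys X A hM hw hes hys hH hX hXes hA hlen hyx hsub
    by_cases hex : ∃ e ∈ X, y ∈ N e
    swap
    · push Not at hex
      refine ⟨∅, by simp, ∅, by simp, ?_, by simp⟩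
      intro e he u hu
      simp only [Finset.sdiff_empty] at he ⊢
      have := hsub e he hu
      have huy : u ≠ y := by rintro rfl; exact hex e he hu
      simpa [huy] using this
    obtain ⟨e, heX, hye⟩ := hex
    have hw' : Walk (flip fun v e => v ∈ N e) (e :: x :: es) (y :: ys) := .cons hye hyx hw
    have hexes : e ∉ x :: es := fun h => hXes e h heX
    have hes' : (e :: x :: es).Nodup := List.nodup_cons.2 ⟨hexes, hes⟩
    have hH' : ∀ f ∈ e :: x :: es, f ∈ H := by
      intro f hf
      rcases List.mem_cons.1 hf with rfl | hf
      · exact hX heX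
      · exact hH f hf
    -- A branch with p edges would already yield a Berge path.
    have hlen' : (e :: x :: es).length < p := by
      refine lt_of_le_of_ne (by simpa using hlen) fun h => hno ?_
      exact hasPath_of_flip_walk hN hinj hs hps hp hw' hes' hys hH' h
    have hXcard : (X.erase e).card + 1 = X.card := Finset.card_erase_add_one heX
    obtain ⟨X₁, hX₁, A₁, hA₁, hN₁, hsub₁, hb₁⟩ := (ih ((X.erase e).card + A.card) (by omega)).1
      e (x :: es) (y :: ys) (X.erase e) A le_rfl hw' hes' hys hH'
      ((Finset.erase_subset _ _).trans hX)
      (by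
        intro f hf
        rcases List.mem_cons.1 hf with rfl | hf
        · simp
        · exact fun h => hXes f hf (Finset.mem_of_mem_erase h)) hA hlen'
      (fun f hf => hsub f (Finset.mem_of_mem_erase hf))
    have hc3 : (X.erase e \ X₁).card + X₁.card = (X.erase e).card :=
      Finset.card_sdiff_add_card_eq_card hX₁
    have hc4 : (A \ A₁).card + A₁.card = A.card := Finset.card_sdiff_add_card_eq_card hA₁
    obtain ⟨X₂, hX₂, A₂, hA₂, hsub₂, hb₂⟩ := (ih ((X.erase e \ X₁).card + (A \ A₁).card) (by omega)).2
      x es y ys (X.erase e \ X₁) (A \ A₁) le_rfl hw hes hys hH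
      ((Finset.sdiff_subset.trans (Finset.erase_subset _ _)).trans hX)
      (fun f hf h => hXes f hf (Finset.mem_of_mem_erase (Finset.mem_sdiff.1 h).1))
      (fun z hz h => hA z hz (Finset.mem_sdiff.1 h).1) hlen hyx hsub₁
    have heX₁ : e ∉ X₁ := fun h => by simpa using hX₁ h
    have heX₂ : e ∉ X₂ := fun h => by simpa using hX₂ h
    have hdX : Disjoint X₁ X₂ := (Finset.disjoint_sdiff).mono_right hX₂
    have hdA : Disjoint A₁ A₂ := (Finset.disjoint_sdiff).mono_right hA₂
    have hcA : (A₁ ∪ A₂).card = A₁.card + A₂.card := Finset.card_union_of_disjoint hdA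
    have hcX : (insert e (X₁ ∪ X₂)).card = X₁.card + X₂.card + 1 := by
      rw [Finset.card_insert_of_notMem (by simp [heX₁, heX₂]), Finset.card_union_of_disjoint hdX]
    refine ⟨insert e (X₁ ∪ X₂), ?_, A₁ ∪ A₂, ?_, ?_, ?_⟩
    · refine Finset.insert_subset heX (Finset.union_subset ?_ ?_)
      · exact hX₁.trans (Finset.erase_subset _ _)
      · exact (hX₂.trans Finset.sdiff_subset).trans (Finset.erase_subset _ _)
    · exact Finset.union_subset hA₁ (hA₂.trans Finset.sdiff_subset)
    · intro f hf u hu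
      have := hsub₂ f (by
        simp only [Finset.mem_sdiff, Finset.mem_union, Finset.mem_insert, Finset.mem_erase] at hf ⊢
        tauto) hu
      simp only [Finset.mem_sdiff, Finset.mem_union] at this ⊢
      tauto
    -- At most d of the s vertices of `e` lie on the branch; all others are reached below `e`.
    · have hAcard : (s : ℤ) - (x :: es).length ≤ A₁.card := by
        have h1 : N e ⊆ A₁ ∪ (y :: ys).toFinset := by
          intro u hu
          have := hsub e heX hu
          simp only [Finset.mem_union] at this ⊢
          rcases this with h | h
          · exact Or.inl (hN₁ (Finset.mem_inter.2 ⟨hu, h⟩))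
          · exact Or.inr h
        have h2 := (Finset.card_le_card h1).trans (Finset.card_union_le _ _)
        rw [hN e (hX heX)] at h2
        have h3 := List.toFinset_card_le (y :: ys)
        have h4 := hw'.length_eq
        simp only [List.length_cons] at h2 h3 h4 ⊢
        push_cast
        omega
      simp only [List.length_cons] at hb₁ hlen' hAcard hb₂ ⊢
      push_cast at hb₁ hAcard hb₂ ⊢
      have hpos : A₁ ≠ ∅ := by
        rintro rfl
        simp only [Finset.card_empty] at hAcard
        push_cast at hAcard
        omega
      have h5 := exploration_bound (a := p - ((es.length : ℤ) + 1) - 1)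
        (b := (s : ℤ) - (es.length + 1)) (m := A₁.card) (t := X₁.card) (by omega) (by omega)
        hAcard (by
          have := hb₁.resolve_left fun h => hpos h.1
          linarith)
      rw [hcX, hcA]
      push_cast
      linarith

/-- A uniform hypergraph with no Berge path of length `p`, where `p` is at most the size `s` of
the edges, has at most `(p - 1) / s` edges for each vertex. -/
theorem card_mul_le_of_not_hasPath (hN : ∀ e ∈ H, (N e).card = s) (hinj : Set.InjOn N H)
    (hs : 2 ≤ s) (hps : p ≤ s) (hp : 1 ≤ p) (hno : ¬ HasPath N H p) [Fintype V] :
    H.card * s ≤ (p - 1) * Fintype.card V := by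
  -- Each root edge with its search uses up `A₁`, and the remaining edges live on `A \ A₁`, so the
  -- bounds for the separate searches add up.
  have key : ∀ (M : ℕ) (X : Finset E) (A : Finset V), X.card ≤ M → X ⊆ H →
      (∀ e ∈ X, N e ⊆ A) → (X.card : ℤ) * s ≤ (p - 1) * A.card := by
    intro M
    induction M with
    | zero =>
      intro X A hX _ _
      obtain rfl : X = ∅ := Finset.card_eq_zero.1 (by omega)
      have : (0 : ℤ) ≤ p - 1 := by omega
      simp only [Finset.card_empty, Nat.cast_zero, zero_mul]
      exact mul_nonneg this (Int.natCast_nonneg _)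
    | succ M ih =>
      intro X A hX hXH hXA
      rcases X.eq_empty_or_nonempty with rfl | ⟨e, he⟩
      · have : (0 : ℤ) ≤ p - 1 := by omega
        simp only [Finset.card_empty, Nat.cast_zero, zero_mul]
        exact mul_nonneg this (Int.natCast_nonneg _)
      have hp1 : ([e] : List E).length < p := by
        refine lt_of_le_of_ne (by simpa using hp) fun h => hno ?_
        exact hasPath_of_flip_walk hN hinj hs hps hp (es := [e]) (.single e) (by simp) (by simp)
          (by simpa using hXH he) h
      have hXcard : (X.erase e).card + 1 = X.card := Finset.card_erase_add_one he
      obtain ⟨X₁, hX₁, A₁, hA₁, hN₁, hsub₁, hb₁⟩ := (depth_first hN hinj hs hps hp hno _).1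
        e [] [] (X.erase e) A le_rfl (.single e) (by simp) (by simp) (by simpa using hXH he)
        ((Finset.erase_subset _ _).trans hXH) (by simp) (by simp) hp1
        (fun f hf => by simpa using hXA f (Finset.mem_of_mem_erase hf))
      have hc3 : (X.erase e \ X₁).card + X₁.card = (X.erase e).card :=
        Finset.card_sdiff_add_card_eq_card hX₁
      have hc4 : (A \ A₁).card + A₁.card = A.card := Finset.card_sdiff_add_card_eq_card hA₁
      have h := ih (X.erase e \ X₁) (A \ A₁) (by omega)
        ((Finset.sdiff_subset.trans (Finset.erase_subset _ _)).trans hXH)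
        (fun f hf => by simpa using hsub₁ f hf)
      have hAcard : (s : ℤ) ≤ A₁.card := by
        have h1 : N e ⊆ A₁ := fun u hu => hN₁ (Finset.mem_inter.2 ⟨hu, hXA e he hu⟩)
        have := Finset.card_le_card h1
        rw [hN e (hXH he)] at this
        exact_mod_cast this
      have hpos : A₁ ≠ ∅ := by
        rintro rfl
        simp only [Finset.card_empty] at hAcard
        push_cast at hAcard
        omega
      simp only [List.length_singleton] at hb₁ hp1
      have h5 := exploration_bound (a := p - 1) (b := s) (m := A₁.card) (t := X₁.card) (by omega)
        (by omega) hAcard (by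
          have := hb₁.resolve_left fun h => hpos h.1
          push_cast at this
          linarith)
      have e1 : (X.card : ℤ) = (X.erase e \ X₁).card + X₁.card + 1 := by omega
      have e2 : (A.card : ℤ) = (A \ A₁).card + A₁.card := by omega
      rw [e1, e2]
      linarith
  have := key H.card H Finset.univ le_rfl subset_rfl (fun _ _ => Finset.subset_univ _)
  rw [Finset.card_univ] at this
  zify [hp]
  exact this

end DepthFirst

/-! ### Crossing neighbours and rotation of paths -/

section Crossing

variable {V : Type*} {R : V → V → Prop}

/-- If the ends of a path in a graph have together at least as many neighbours on the path as the
path has vertices, then the neighbours cross. -/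
theorem exists_crossing [DecidableEq V] (l : List V) (hne : l ≠ []) {S T : Finset V}
    (hS : ∀ v ∈ S, v ∈ l) (hT : ∀ v ∈ T, v ∈ l) (hS' : l.head hne ∉ S)
    (hT' : l.getLast hne ∉ T) (hcard : l.length ≤ S.card + T.card) :
    ∃ l₁ a b l₂, l = l₁ ++ a :: b :: l₂ ∧ b ∈ S ∧ a ∈ T := by
  set q := l.length - 1 with hq
  have hpos : 0 < l.length := List.length_pos_iff.2 hne
  -- `I` and `J` mark the same q = length - 1 gaps of the path, by the right end lying in `S` and
  -- the left end lying in `T`. More than q marks force a common gap.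
  let I : Finset (Fin q) := Finset.univ.filter fun i => l[i.1 + 1]'(by omega) ∈ S
  let J : Finset (Fin q) := Finset.univ.filter fun i => l[i.1]'(by omega) ∈ T
  have hI : S.card ≤ I.card := by
    refine Finset.card_le_card_of_surjOn (fun i : Fin q => l[i.1 + 1]'(by omega)) ?_
    intro v hv
    obtain ⟨i, hi, rfl⟩ := List.getElem_of_mem (hS v hv)
    have hi0 : i ≠ 0 := by
      rintro rfl
      exact hS' (by simpa [List.head_eq_getElem] using hv)
    obtain ⟨j, rfl⟩ := Nat.exists_eq_succ_of_ne_zero hi0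
    exact ⟨⟨j, by omega⟩, by simpa [I] using hv, rfl⟩
  have hJ : T.card ≤ J.card := by
    refine Finset.card_le_card_of_surjOn (fun i : Fin q => l[i.1]'(by omega)) ?_
    intro v hv
    obtain ⟨i, hi, rfl⟩ := List.getElem_of_mem (hT v hv)
    have hi0 : i ≠ l.length - 1 := by
      rintro rfl
      exact hT' (by simpa [List.getLast_eq_getElem] using hv)
    exact ⟨⟨i, by omega⟩, by simpa [J] using hv, rfl⟩
  obtain ⟨i, hi⟩ : (I ∩ J).Nonempty := by
    rw [← Finset.card_pos]
    have h1 := Finset.card_union_add_card_inter I J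
    have h2 : (I ∪ J).card ≤ q := (Finset.card_le_univ _).trans (by simp)
    omega
  simp only [I, J, Finset.mem_inter, Finset.mem_filter, Finset.mem_univ, true_and] at hi
  refine ⟨l.take i, _, _, l.drop (i + 2), ?_, hi.1, hi.2⟩
  rw [List.cons_getElem_drop_succ, List.cons_getElem_drop_succ, List.take_append_drop]

/-- A path whose end neighbours cross spans a cycle, so that a further vertex with a neighbour on
the path makes the path longer. -/
theorem exists_longer_chain (hsymm : ∀ u v, R u v → R v u) {l₁ l₂ : List V} {a b x z : V}
    (hc : (l₁ ++ a :: b :: l₂).IsChain R) (hb : R ((l₁ ++ [a]).head (by simp)) b)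
    (ha : R ((b :: l₂).getLast (by simp)) a) (hz : z ∈ l₁ ++ a :: b :: l₂) (hxz : R x z) :
    ∃ l : List V, l.Perm (x :: (l₁ ++ a :: b :: l₂)) ∧ l.IsChain R := by
  obtain ⟨c, hperm, hchain, hclose⟩ : ∃ c : List V, c.Perm (l₁ ++ a :: b :: l₂) ∧ c.IsChain R ∧
      ∀ u ∈ c.getLast?, ∀ v ∈ c.head?, R u v := by
    -- The cyclic order is a, back to the head, over to b, on to the last vertex, and back to a.
    -- Cutting this cycle in front of z makes room for x.
    refine ⟨(l₁ ++ [a]).reverse ++ b :: l₂, ?_, ?_, ?_⟩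
    · refine ((List.reverse_perm _).append_right _).trans ?_
      simp
    · have h0 : l₁ ++ a :: b :: l₂ = (l₁ ++ [a]) ++ b :: l₂ := by simp
      rw [h0, List.isChain_append] at hc
      rw [List.isChain_append]
      refine ⟨?_, hc.2.1, ?_⟩
      · rw [List.isChain_reverse]
        exact hc.1.imp fun u v h => hsymm u v h
      · intro u hu v hv
        rw [List.getLast?_reverse, List.head?_eq_some_head (by simp)] at hu
        cases hu
        cases hv
        exact hb
    · intro u hu v hv
      have hv' : a = v := by simpa using hv
      rw [List.getLast?_append_of_ne_nil _ (by simp),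
        List.getLast?_eq_some_getLast (by simp)] at hu
      cases hu
      exact hv' ▸ ha
  obtain ⟨c₁, c₂, rfl⟩ := List.append_of_mem (hperm.mem_iff.2 hz)
  refine ⟨x :: z :: (c₂ ++ c₁), ?_, ?_⟩
  · refine (List.Perm.cons x ?_).trans (hperm.cons x)
    exact (List.perm_append_comm (l₁ := z :: c₂) (l₂ := c₁))
  · rw [List.isChain_append] at hchain
    have : (z :: c₂ ++ c₁).IsChain R := by
      rw [List.isChain_append]
      refine ⟨hchain.2.1, hchain.1, ?_⟩
      intro u hu v hv
      refine hclose u ?_ v ?_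
      · rw [List.getLast?_append_of_ne_nil _ (by simp)]
        exact hu
      · rw [List.head?_append_of_ne_nil _ (by rintro rfl; simp at hv)]
        exact hv
    exact .cons_cons hxz this

end Crossing

/-! ### Red edges and blue cliques in graphs without long paths -/

section WeightedGraph

variable {V : Type*}

/-- A longest path inside a nonempty vertex set. -/
theorem exists_longest_chain {R : V → V → Prop} {p : ℕ}
    (hpath : ∀ l : List V, l.IsChain R → l.Nodup → l.length ≤ p) {U : Finset V}
    (hU : U.Nonempty) :
    ∃ l : List V, l ≠ [] ∧ l.IsChain R ∧ l.Nodup ∧ (∀ v ∈ l, v ∈ U) ∧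
      ∀ l' : List V, l'.IsChain R → l'.Nodup → (∀ v ∈ l', v ∈ U) → l'.length ≤ l.length := by
  classical
  let P : ℕ → Prop := fun m =>
    ∃ l : List V, l.IsChain R ∧ l.Nodup ∧ (∀ v ∈ l, v ∈ U) ∧ l.length = m
  obtain ⟨v, hv⟩ := hU
  have h1 : P 1 := ⟨[v], by simp, by simp, by simpa using hv, rfl⟩
  have hle : ∀ m, P m → m ≤ p := by
    rintro m ⟨l, h1, h2, -, rfl⟩
    exact hpath l h1 h2
  obtain ⟨l, hl1, hl2, hl3, hl4⟩ := Nat.findGreatest_spec (P := P) (hle 1 h1) h1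
  have h1le := Nat.le_findGreatest (P := P) (hle 1 h1) h1
  refine ⟨l, ?_, hl1, hl2, hl3, fun l' h1 h2 h3 => ?_⟩
  · rintro rfl
    simp only [List.length_nil] at hl4
    omega
  · rw [hl4]
    exact Nat.le_findGreatest (hpath l' h1 h2) ⟨l', h1, h2, h3, rfl⟩

variable [DecidableEq V]

/-- The red edges inside `U`. -/
def redIn (Rd : Finset (Finset V)) (U : Finset V) : Finset (Finset V) :=
  Rd.filter (· ⊆ U)

/-- The blue cliques with `s` vertices inside `U`. -/
def cliquesIn (s : ℕ) (Bl : Finset (Finset V)) (U : Finset V) : Finset (Finset V) :=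
  (U.powersetCard s).filter fun S => S.powersetCard 2 ⊆ Bl

/-- Two vertices are joined by a red or a blue edge. -/
def PairAdj (Rd Bl : Finset (Finset V)) (u v : V) : Prop :=
  u ≠ v ∧ ({u, v} : Finset V) ∈ Rd ∪ Bl

variable {Rd Bl : Finset (Finset V)} {s : ℕ}

theorem PairAdj.symm {u v : V} (h : PairAdj Rd Bl u v) : PairAdj Rd Bl v u :=
  ⟨h.1.symm, by rw [Finset.pair_comm]; exact h.2⟩

theorem card_redIn_le (hRd : ∀ e ∈ Rd, e.card = 2) (U : Finset V) (v : V) :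
    (redIn Rd U).card ≤
      (redIn Rd (U.erase v)).card + (U.filter fun u => u ≠ v ∧ {v, u} ∈ Rd).card := by
  have h : redIn Rd U ⊆ redIn Rd (U.erase v) ∪
      (U.filter fun u => u ≠ v ∧ {v, u} ∈ Rd).image fun u => {v, u} := by
    intro e he
    rw [redIn, Finset.mem_filter] at he
    rw [Finset.mem_union]
    by_cases hv : v ∈ e
    · right
      have hc : (e.erase v).card = 1 := by rw [Finset.card_erase_of_mem hv, hRd e he.1]
      obtain ⟨u, hu⟩ := Finset.card_eq_one.1 hc
      have hue : u ∈ e.erase v := by rw [hu]; simp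
      have he' : e = {v, u} := by rw [← hu, Finset.insert_erase hv]
      rw [Finset.mem_image]
      refine ⟨u, ?_, he'.symm⟩
      rw [Finset.mem_filter]
      exact ⟨he.2 (Finset.mem_of_mem_erase hue), Finset.ne_of_mem_erase hue, he' ▸ he.1⟩
    · left
      rw [redIn, Finset.mem_filter]
      exact ⟨he.1, Finset.subset_erase.2 ⟨he.2, hv⟩⟩
  exact (Finset.card_le_card h).trans ((Finset.card_union_le _ _).trans
    (Nat.add_le_add_left Finset.card_image_le _))

/-- A clique through `v` is `v` together with s - 1 of its blue neighbours. -/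
theorem card_cliquesIn_le (U : Finset V) (v : V) :
    (cliquesIn s Bl U).card ≤ (cliquesIn s Bl (U.erase v)).card +
      (U.filter fun u => u ≠ v ∧ {v, u} ∈ Bl).card.choose (s - 1) := by
  set W := U.filter fun u => u ≠ v ∧ {v, u} ∈ Bl with hW
  have h : cliquesIn s Bl U ⊆ cliquesIn s Bl (U.erase v) ∪
      (W.powersetCard (s - 1)).image (insert v) := by
    intro S hS
    rw [cliquesIn, Finset.mem_filter, Finset.mem_powersetCard] at hS
    rw [Finset.mem_union]
    by_cases hv : v ∈ S
    · right
      rw [Finset.mem_image]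
      refine ⟨S.erase v, ?_, Finset.insert_erase hv⟩
      rw [Finset.mem_powersetCard, Finset.card_erase_of_mem hv, hS.1.2]
      refine ⟨fun u hu => ?_, rfl⟩
      rw [hW, Finset.mem_filter]
      have huv := Finset.ne_of_mem_erase hu
      have huS := Finset.mem_of_mem_erase hu
      refine ⟨hS.1.1 huS, huv, hS.2 ?_⟩
      rw [Finset.mem_powersetCard]
      exact ⟨Finset.insert_subset hv (Finset.singleton_subset_iff.2 huS),
        Finset.card_pair huv.symm⟩
    · left
      rw [cliquesIn, Finset.mem_filter, Finset.mem_powersetCard]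
      exact ⟨⟨Finset.subset_erase.2 ⟨hS.1.1, hv⟩, hS.1.2⟩, hS.2⟩
  refine (Finset.card_le_card h).trans ((Finset.card_union_le _ _).trans
    (Nat.add_le_add_left ?_ _))
  exact Finset.card_image_le.trans (Finset.card_powersetCard _ _).le

/-- Double counting of the pairs formed by a clique and a blue edge inside it. -/
theorem card_cliquesIn_mul_le (U : Finset V) :
    (cliquesIn s Bl U).card * s.choose 2 ≤
      (Bl ∩ U.powersetCard 2).card * (U.card - 2).choose (s - 2) := by
  refine Finset.card_mul_le_card_mul (fun S e : Finset V => e ⊆ S) ?_ ?_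
  · intro S hS
    rw [cliquesIn, Finset.mem_filter, Finset.mem_powersetCard] at hS
    rw [← hS.1.2, ← Finset.card_powersetCard]
    refine Finset.card_le_card fun e he => ?_
    rw [Finset.mem_bipartiteAbove, Finset.mem_inter, Finset.mem_powersetCard]
    have he' := Finset.mem_powersetCard.1 he
    exact ⟨⟨hS.2 he, he'.1.trans hS.1.1, he'.2⟩, he'.1⟩
  · intro e he
    rw [Finset.mem_inter, Finset.mem_powersetCard] at he
    have hc : (U \ e).card = U.card - 2 := by rw [Finset.card_sdiff_of_subset he.2.1, he.2.2]
    rw [← hc, ← Finset.card_powersetCard]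
    refine Finset.card_le_card_of_injOn (fun S => S \ e) ?_ ?_
    · intro S hS
      rw [Finset.mem_coe, Finset.mem_bipartiteBelow, cliquesIn, Finset.mem_filter,
        Finset.mem_powersetCard] at hS
      rw [Finset.mem_coe, Finset.mem_powersetCard, Finset.card_sdiff_of_subset hS.2, he.2.2, hS.1.1.2]
      exact ⟨Finset.sdiff_subset_sdiff hS.1.1.1 subset_rfl, rfl⟩
    · intro S hS S' hS' hSS'
      rw [Finset.mem_coe, Finset.mem_bipartiteBelow] at hS hS'
      rw [← Finset.sdiff_union_of_subset hS.2, ← Finset.sdiff_union_of_subset hS'.2]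
      exact congrArg (· ∪ e) hSS'

/-- The weight of a small vertex set. -/
theorem weight_le_max (hRd : ∀ e ∈ Rd, e.card = 2) (hdisj : Disjoint Rd Bl) (hs : 2 ≤ s)
    (U : Finset V) {c : ℝ} (h2 : (U.card.choose 2 : ℝ) ≤ c) (hsc : (U.card.choose s : ℝ) ≤ c) :
    ((redIn Rd U).card : ℝ) + (cliquesIn s Bl U).card ≤ c := by
  by_cases hU : U.card < 2
  · have h1 : redIn Rd U = ∅ := by
      refine Finset.filter_eq_empty_iff.2 fun e he hsub => ?_
      have := Finset.card_le_card hsub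
      rw [hRd e he] at this
      omega
    have h3 : cliquesIn s Bl U = ∅ := by
      rw [cliquesIn, Finset.powersetCard_eq_empty.2 (by omega), Finset.filter_empty]
    rw [h1, h3]
    simpa using (Nat.cast_nonneg _).trans h2
  have hcl := card_cliquesIn_mul_le (Bl := Bl) (s := s) U
  have hrb : (redIn Rd U).card + (Bl ∩ U.powersetCard 2).card ≤ U.card.choose 2 := by
    rw [← Finset.card_powersetCard 2 U, ← Finset.card_union_of_disjoint]
    · refine Finset.card_le_card (Finset.union_subset (fun e he => ?_) Finset.inter_subset_right)
      rw [redIn, Finset.mem_filter] at he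
      exact Finset.mem_powersetCard.2 ⟨he.2, hRd e he.1⟩
    · exact hdisj.mono (Finset.filter_subset _ _) Finset.inter_subset_left
  set r := (redIn Rd U).card
  set q := (cliquesIn s Bl U).card
  set b := (Bl ∩ U.powersetCard 2).card
  set t := (U.card - 2).choose (s - 2)
  have hc2 : 0 < s.choose 2 := Nat.choose_pos hs
  have hid' : U.card.choose s * s.choose 2 = U.card.choose 2 * t := Nat.choose_mul hs
  have hcl' : (q : ℝ) * s.choose 2 ≤ b * t := by exact_mod_cast hcl
  have hrb' : (r : ℝ) + b ≤ U.card.choose 2 := by exact_mod_cast hrb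
  have hidr : (U.card.choose s : ℝ) * s.choose 2 = U.card.choose 2 * t := by exact_mod_cast hid'
  have hc2' : (0 : ℝ) < s.choose 2 := by exact_mod_cast hc2
  have hr0 : (0 : ℝ) ≤ r := Nat.cast_nonneg _
  have hb0 : (0 : ℝ) ≤ b := Nat.cast_nonneg _
  have ht0 : (0 : ℝ) ≤ t := Nat.cast_nonneg _
  -- A red pair has weight 1 and a blue pair accounts for at most t / C(s, 2) cliques. Depending on
  -- which is larger, the extreme case is all red or all blue, with weight C(|U|, 2) or C(|U|, s).
  rcases le_total (t : ℝ) (s.choose 2) with h | h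
  · have : (q : ℝ) ≤ b := by
      refine le_of_mul_le_mul_right ?_ hc2'
      exact hcl'.trans (mul_le_mul_of_nonneg_left h hb0)
    linarith
  · refine le_of_mul_le_mul_right ?_ hc2'
    calc ((r : ℝ) + q) * s.choose 2 ≤ r * t + b * t := by nlinarith
      _ = (r + b) * t := by ring
      _ ≤ U.card.choose 2 * t := mul_le_mul_of_nonneg_right hrb' ht0
      _ = U.card.choose s * s.choose 2 := hidr.symm
      _ ≤ c * s.choose 2 := mul_le_mul_of_nonneg_right hsc hc2'.le

/-- A Kopylov-type bound for red edges and blue cliques in a graph without long paths. -/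
theorem weight_le (hRd : ∀ e ∈ Rd, e.card = 2) (hdisj : Disjoint Rd Bl) (hs : 2 ≤ s) {p : ℕ}
    (hpath : ∀ l : List V, l.IsChain (PairAdj Rd Bl) → l.Nodup → l.length ≤ p) {γ : ℝ}
    (hdeg : ∀ x y : ℕ, 2 * (x + y) + 1 ≤ p → (x : ℝ) + y.choose (s - 1) ≤ γ)
    (hsmall : ∀ m ≤ p, (m.choose 2 : ℝ) ≤ γ * m ∧ (m.choose s : ℝ) ≤ γ * m) (U : Finset V) :
    ((redIn Rd U).card : ℝ) + (cliquesIn s Bl U).card ≤ γ * U.card := by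
  classical
  induction U using Finset.strongInduction with
  | H U ih =>
  rcases U.eq_empty_or_nonempty with rfl | hU
  · simpa using weight_le_max hRd hdisj hs (∅ : Finset V) (hsmall 0 (by omega)).1
      (hsmall 0 (by omega)).2
  -- Deleting a vertex of red degree x and blue degree y costs at most x + C(y, s - 1), which `hdeg`
  -- bounds by γ when the total degree is small. Otherwise all degrees are at least p/2, and the end
  -- degrees of a longest path add up to at least its number of vertices.
  by_cases hlow : ∃ v ∈ U, 2 * ((U.filter fun u => u ≠ v ∧ {v, u} ∈ Rd).card +
      (U.filter fun u => u ≠ v ∧ {v, u} ∈ Bl).card) + 1 ≤ p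
  · obtain ⟨v, hv, hd⟩ := hlow
    have h1 : ((redIn Rd U).card : ℝ) ≤ _ := Nat.cast_le.2 (card_redIn_le hRd U v)
    have h2 : ((cliquesIn s Bl U).card : ℝ) ≤ _ :=
      Nat.cast_le.2 (card_cliquesIn_le (Bl := Bl) (s := s) U v)
    have h3 := hdeg _ _ hd
    have h4 := ih _ (Finset.erase_ssubset hv)
    have h5 : ((U.erase v).card : ℝ) = U.card - 1 := by
      rw [← Finset.card_erase_add_one hv]
      push_cast
      ring
    rw [h5] at h4
    push_cast at h1 h2
    linarith
  push Not at hlow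
  obtain ⟨l, hne, hchain, hnd, hlU, hmax⟩ := exists_longest_chain hpath hU
  have hlp := hpath l hchain hnd
  have hdegree : ∀ v ∈ U, p ≤ 2 * (U.filter fun u => PairAdj Rd Bl v u).card := by
    intro v hv
    have h1 := hlow v hv
    have h2 : (U.filter fun u => PairAdj Rd Bl v u) =
        (U.filter fun u => u ≠ v ∧ {v, u} ∈ Rd) ∪ (U.filter fun u => u ≠ v ∧ {v, u} ∈ Bl) := by
      ext u
      simp only [PairAdj, Finset.mem_filter, Finset.mem_union, ne_comm (a := v)]
      tauto
    rw [h2, Finset.card_union_of_disjoint]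
    · omega
    · rw [Finset.disjoint_left]
      intro u hu hu'
      exact Finset.disjoint_left.1 hdisj (Finset.mem_filter.1 hu).2.2
        (Finset.mem_filter.1 hu').2.2
  have hmem : ∀ l' : List V, l'.IsChain (PairAdj Rd Bl) → ∀ x ∈ U, l'.Perm (x :: l) → x ∈ l := by
    intro l' hl' x hx hperm
    by_contra hxl
    have h1 := hmax l' hl' (hperm.nodup_iff.2 (List.nodup_cons.2 ⟨hxl, hnd⟩)) (by
      intro v hv
      rcases List.mem_cons.1 (hperm.mem_iff.1 hv) with rfl | hv
      · exact hx
      · exact hlU v hv)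
    rw [hperm.length_eq, List.length_cons] at h1
    omega
  obtain ⟨l₁, a, b, l₂, rfl, hb, ha⟩ := exists_crossing l hne
    (S := U.filter fun u => PairAdj Rd Bl (l.head hne) u)
    (T := U.filter fun u => PairAdj Rd Bl (l.getLast hne) u)
    (by
      intro v hv
      rw [Finset.mem_filter] at hv
      refine hmem (v :: l) ?_ v hv.1 (List.Perm.refl _)
      rw [← List.cons_head_tail hne]
      refine .cons_cons hv.2.symm ?_
      rwa [List.cons_head_tail])
    (by
      intro v hv
      rw [Finset.mem_filter] at hv
      refine hmem (l ++ [v]) ?_ v hv.1 (List.perm_append_singleton _ _)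
      rw [List.isChain_append]
      refine ⟨hchain, by simp, ?_⟩
      intro u hu w hw
      rw [List.getLast?_eq_some_getLast hne] at hu
      cases hu
      cases hw
      exact hv.2)
    (by simp [PairAdj]) (by simp [PairAdj])
    (by
      have h1 := hdegree _ (hlU _ (List.head_mem hne))
      have h2 := hdegree _ (hlU _ (List.getLast_mem hne))
      omega)
  set l := l₁ ++ a :: b :: l₂ with hl
  rw [Finset.mem_filter] at hb ha
  -- The longest path closes up to a cycle, so an edge leaving it would give a longer path. Its
  -- vertex set is therefore a component with at most p vertices, and `hsmall` applies to it.
  have hclosed : ∀ z ∈ l, ∀ x ∈ U, PairAdj Rd Bl x z → x ∈ l := by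
    intro z hz x hx hxz
    obtain ⟨l', hperm, hl'⟩ := exists_longer_chain (fun _ _ h => PairAdj.symm h) hchain
      (b := b) (a := a) (by
        have : (l₁ ++ [a]).head (by simp) = l.head hne := by
          cases l₁ <;> simp [hl]
        rw [this]
        exact hb.2)
      (by
        have : (b :: l₂).getLast (by simp) = l.getLast hne := by
          simp [hl, List.getLast_cons]
        rw [this]
        exact ha.2) hz hxz
    exact hmem l' hl' x hx hperm
  set Z := l.toFinset with hZ
  have hZU : Z ⊆ U := fun v hv => hlU v (List.mem_toFinset.1 hv)
  have hZcard : Z.card ≤ p := (List.toFinset_card_le l).trans hlp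
  have hZne : Z.Nonempty := ⟨a, by simp [hZ, hl]⟩
  have hsplit : ∀ S ⊆ U, (∀ u ∈ S, ∀ v ∈ S, u ≠ v → {u, v} ∈ Rd ∪ Bl) → S ⊆ Z ∨ S ⊆ U \ Z := by
    intro S hSU hS
    by_cases h : ∃ z ∈ S, z ∈ Z
    · left
      obtain ⟨z, hzS, hz⟩ := h
      intro x hx
      by_cases hxz : x = z
      · exact hxz ▸ hz
      · exact List.mem_toFinset.2
          (hclosed z (List.mem_toFinset.1 hz) x (hSU hx) ⟨hxz, hS x hx z hzS hxz⟩)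
    · right
      push Not at h
      exact fun x hx => Finset.mem_sdiff.2 ⟨hSU hx, h x hx⟩
  have h1 : (redIn Rd U).card ≤ (redIn Rd Z).card + (redIn Rd (U \ Z)).card := by
    refine (Finset.card_le_card fun e he => ?_).trans (Finset.card_union_le _ _)
    rw [redIn, Finset.mem_filter] at he
    rw [Finset.mem_union, redIn, redIn, Finset.mem_filter, Finset.mem_filter]
    have := hsplit e he.2 (by
      intro u hu v hv huv
      have : ({u, v} : Finset V) = e := by
        refine Finset.eq_of_subset_of_card_le ?_ ?_
        · exact Finset.insert_subset hu (Finset.singleton_subset_iff.2 hv)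
        · rw [hRd e he.1, Finset.card_pair huv]
      rw [this]
      exact Finset.mem_union_left _ he.1)
    tauto
  have h2 : (cliquesIn s Bl U).card ≤ (cliquesIn s Bl Z).card + (cliquesIn s Bl (U \ Z)).card := by
    refine (Finset.card_le_card fun S hS => ?_).trans (Finset.card_union_le _ _)
    rw [cliquesIn, Finset.mem_filter, Finset.mem_powersetCard] at hS
    rw [Finset.mem_union, cliquesIn, cliquesIn, Finset.mem_filter, Finset.mem_filter,
      Finset.mem_powersetCard, Finset.mem_powersetCard]
    have := hsplit S hS.1.1 (by
      intro u hu v hv huv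
      refine Finset.mem_union_right _ (hS.2 ?_)
      rw [Finset.mem_powersetCard]
      exact ⟨Finset.insert_subset hu (Finset.singleton_subset_iff.2 hv), Finset.card_pair huv⟩)
    tauto
  have h3 := weight_le_max hRd hdisj hs Z (hsmall _ hZcard).1 (hsmall _ hZcard).2
  have h4 := ih (U \ Z) (Finset.sdiff_ssubset hZU hZne)
  have h5 : (U.card : ℝ) = (U \ Z).card + Z.card := by
    rw [← Finset.card_sdiff_add_card_eq_card hZU]
    push_cast
    ring
  have h1' : ((redIn Rd U).card : ℝ) ≤ (redIn Rd Z).card + (redIn Rd (U \ Z)).card := by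
    exact_mod_cast h1
  have h2' : ((cliquesIn s Bl U).card : ℝ) ≤ (cliquesIn s Bl Z).card + (cliquesIn s Bl (U \ Z)).card := by
    exact_mod_cast h2
  rw [h5, mul_add]
  linarith

end WeightedGraph

/-! ### Red-blue decomposition and the Turán bound for longer paths -/

section RedBlue

variable {V E : Type*} [DecidableEq V] {N : E → Finset V} {H : Finset E} {s : ℕ}

/-- A path in the graph of the pairs gives a Berge path. -/
theorem exists_walk_of_chain {Rd Bl : Finset (Finset V)} {m : Finset V → E}
    (hinj : Set.InjOn m (Rd ∪ Bl : Finset (Finset V)))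
    (hm : ∀ q ∈ Rd ∪ Bl, m q ∈ H ∧ q ⊆ N (m q)) (l : List V) (hne : l ≠ [])
    (hl : l.IsChain (PairAdj Rd Bl)) (hnd : l.Nodup) :
    ∃ es, Walk (fun v e => v ∈ N e) l es ∧ es.Nodup ∧
      ∀ e ∈ es, e ∈ H ∧ ∃ q ∈ Rd ∪ Bl, m q = e ∧ ∀ v ∈ q, v ∈ l := by
  induction l with
  | nil => exact absurd rfl hne
  | cons u l ih =>
    cases l with
    | nil => exact ⟨[], .single u, by simp, by simp⟩
    | cons v l =>
      rw [List.isChain_cons_cons] at hl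
      rw [List.nodup_cons] at hnd
      obtain ⟨es, hw, hes, hesq⟩ := ih (by simp) hl.2 hnd.2
      have hq := hl.1.2
      have hmq := hm _ hq
      refine ⟨m {u, v} :: es, .cons (hmq.2 (by simp)) (hmq.2 (by simp)) hw, ?_, ?_⟩
      · rw [List.nodup_cons]
        refine ⟨fun h => ?_, hes⟩
        obtain ⟨-, q, hq', hqe, hql⟩ := hesq _ h
        have := hinj hq' hq hqe
        exact hnd.1 (hql u (by rw [this]; simp))
      · intro e he
        rcases List.mem_cons.1 he with rfl | he
        · refine ⟨hmq.1, _, hq, rfl, ?_⟩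
          intro w hw
          simp only [Finset.mem_insert, Finset.mem_singleton] at hw
          rcases hw with rfl | rfl <;> simp
        · obtain ⟨h1, q, h2, h3, h4⟩ := hesq e he
          exact ⟨h1, q, h2, h3, fun w hw => List.mem_cons_of_mem _ (h4 w hw)⟩

variable [DecidableEq E]

/-- Red-blue decomposition: the edges of a hypergraph split into a part `B` and a rest, such that
the vertex pairs covered by `B` (blue) and suitable further pairs (red), one for each edge not
in `B`, are contained in distinct edges. -/
theorem exists_red_blue (N : E → Finset V) {H : Finset E} (hH : H.Nonempty) :
    ∃ B ⊆ H, ∃ Rd : Finset (Finset V), ∃ m : Finset V → E,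
      (∀ e ∈ Rd, e.card = 2) ∧
      Disjoint Rd (B.biUnion fun e => (N e).powersetCard 2) ∧
      Rd.card = (H \ B).card ∧
      Set.InjOn m (Rd ∪ B.biUnion fun e => (N e).powersetCard 2 : Finset (Finset V)) ∧
      ∀ q ∈ Rd ∪ B.biUnion fun e => (N e).powersetCard 2, m q ∈ H ∧ q ⊆ N (m q) := by
  classical
  let t : E → Finset (Finset V) := fun e => (N e).powersetCard 2
  -- Maximality of |B| minus the number of pairs covered by B gives Hall's condition twice.
  -- Enlarging B does not help, so edges outside B can be matched to uncovered pairs; shrinking B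
  -- does not help, so covered pairs can be matched to edges of B.
  obtain ⟨B, hB, hmax⟩ := Finset.exists_max_image H.powerset
    (fun B => (B.card : ℤ) - (B.biUnion t).card) ⟨∅, by simp⟩
  rw [Finset.mem_powerset] at hB
  set D := B.biUnion t with hD
  -- the edges outside `B` get pairs outside `D`
  obtain ⟨f, hfinj, hf⟩ := (Finset.all_card_le_biUnion_card_iff_exists_injective
    (fun e : (H \ B : Finset E) => t e.1 \ D)).1 (by
      intro C
      have h1 := hmax (B ∪ C.image Subtype.val) (by
        rw [Finset.mem_powerset]
        refine Finset.union_subset hB fun e he => ?_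
        obtain ⟨x, -, rfl⟩ := Finset.mem_image.1 he
        exact (Finset.mem_sdiff.1 x.2).1)
      have h2 : (B ∪ C.image Subtype.val).card = B.card + C.card := by
        rw [Finset.card_union_of_disjoint, Finset.card_image_of_injective _ Subtype.val_injective]
        rw [Finset.disjoint_right]
        intro e he
        obtain ⟨x, -, rfl⟩ := Finset.mem_image.1 he
        exact (Finset.mem_sdiff.1 x.2).2
      have h3 : ((B ∪ C.image Subtype.val).biUnion t).card ≤
          D.card + (C.biUnion fun e => t e.1 \ D).card := by
        refine (Finset.card_le_card fun q hq => ?_).trans (Finset.card_union_le _ _)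
        rw [Finset.mem_biUnion] at hq
        obtain ⟨e, he, hq⟩ := hq
        by_cases hqD : q ∈ D
        · exact Finset.mem_union_left _ hqD
        · rcases Finset.mem_union.1 he with he | he
          · exact absurd (Finset.mem_biUnion.2 ⟨e, he, hq⟩) hqD
          · obtain ⟨x, hx, rfl⟩ := Finset.mem_image.1 he
            exact Finset.mem_union_right _
              (Finset.mem_biUnion.2 ⟨x, hx, Finset.mem_sdiff.2 ⟨hq, hqD⟩⟩)
      simp only [h2] at h1
      push_cast at h1
      omega)
  -- the pairs in `D` get edges in `B`
  obtain ⟨g, hginj, hg⟩ := (Finset.all_card_le_biUnion_card_iff_exists_injective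
    (fun q : D => B.filter fun e => q.1 ∈ t e)).1 (by
      intro T
      set W := T.biUnion fun q : D => B.filter fun e => q.1 ∈ t e with hW
      have hWB : W ⊆ B := by
        intro e he
        rw [hW, Finset.mem_biUnion] at he
        obtain ⟨q, -, he⟩ := he
        exact (Finset.mem_filter.1 he).1
      have h1 := hmax (B \ W) (Finset.mem_powerset.2 (Finset.sdiff_subset.trans hB))
      have h2 : (B \ W).card + W.card = B.card := Finset.card_sdiff_add_card_eq_card hWB
      have h3 : ((B \ W).biUnion t).card + T.card ≤ D.card := by
        rw [← Finset.card_image_of_injective T Subtype.val_injective, ← Finset.card_union_of_disjoint]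
        · refine Finset.card_le_card (Finset.union_subset ?_ ?_)
          · exact Finset.biUnion_subset_biUnion_of_subset_left _ Finset.sdiff_subset
          · intro q hq
            obtain ⟨x, -, rfl⟩ := Finset.mem_image.1 hq
            exact x.2
        · rw [Finset.disjoint_right]
          intro q hq hq'
          obtain ⟨x, hx, rfl⟩ := Finset.mem_image.1 hq
          obtain ⟨e, he, hxe⟩ := Finset.mem_biUnion.1 hq'
          rw [Finset.mem_sdiff] at he
          exact he.2 (Finset.mem_biUnion.2 ⟨x, hx, Finset.mem_filter.2 ⟨he.1, hxe⟩⟩)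
      omega)
  let Rd := Finset.univ.image f
  have hRdD : ∀ q ∈ Rd, q ∉ D := by
    intro q hq
    obtain ⟨x, -, rfl⟩ := Finset.mem_image.1 hq
    exact (Finset.mem_sdiff.1 (hf x)).2
  have hfRd : ∀ q ∈ Rd, ∃ x, f x = q := fun q hq => by
    obtain ⟨x, -, rfl⟩ := Finset.mem_image.1 hq
    exact ⟨x, rfl⟩
  obtain ⟨e₀, -⟩ := hH
  -- `e₀` is a default value, taken only at pairs that are neither red nor blue.
  let m : Finset V → E := fun q =>
    if h : q ∈ D then g ⟨q, h⟩ else if h : ∃ x, f x = q then (Classical.choose h).1 else e₀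
  have hmD : ∀ q (h : q ∈ D), m q = g ⟨q, h⟩ := fun q h => by simp only [m, dif_pos h]
  have hmf : ∀ x, m (f x) = x.1 := by
    intro x
    have h1 : f x ∉ D := (Finset.mem_sdiff.1 (hf x)).2
    have h2 : ∃ y, f y = f x := ⟨x, rfl⟩
    simp only [m, dif_neg h1, dif_pos h2]
    exact congrArg Subtype.val (hfinj (Classical.choose_spec h2))
  have hgB : ∀ q, g q ∈ B := fun q => (Finset.mem_filter.1 (hg q)).1
  refine ⟨B, hB, Rd, m, ?_, Finset.disjoint_left.2 hRdD, ?_, ?_, ?_⟩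
  · intro q hq
    obtain ⟨x, rfl⟩ := hfRd q hq
    exact (Finset.mem_powersetCard.1 (Finset.mem_sdiff.1 (hf x)).1).2
  · rw [Finset.card_image_of_injective _ hfinj, Finset.card_univ, Fintype.card_coe]
  · intro q hq q' hq' hqq
    rw [Finset.mem_coe, Finset.mem_union] at hq hq'
    rcases hq with hq | hq <;> rcases hq' with hq' | hq'
    · obtain ⟨x, rfl⟩ := hfRd q hq
      obtain ⟨y, rfl⟩ := hfRd q' hq'
      rw [hmf, hmf] at hqq
      rw [Subtype.ext hqq]
    · obtain ⟨x, rfl⟩ := hfRd q hq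
      rw [hmf, hmD q' hq'] at hqq
      exact absurd (hqq ▸ hgB _) (Finset.mem_sdiff.1 x.2).2
    · obtain ⟨x, rfl⟩ := hfRd q' hq'
      rw [hmf, hmD q hq] at hqq
      exact absurd (hqq ▸ hgB _) (Finset.mem_sdiff.1 x.2).2
    · rw [hmD q hq, hmD q' hq'] at hqq
      exact congrArg Subtype.val (hginj hqq)
  · intro q hq
    rcases Finset.mem_union.1 hq with hq | hq
    · obtain ⟨x, rfl⟩ := hfRd q hq
      rw [hmf]
      exact ⟨(Finset.mem_sdiff.1 x.2).1,
        (Finset.mem_powersetCard.1 (Finset.mem_sdiff.1 (hf x)).1).1⟩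
    · rw [hmD q hq]
      exact ⟨hB (hgB _), (Finset.mem_powersetCard.1 (Finset.mem_filter.1 (hg ⟨q, hq⟩)).2).1⟩

/-- A uniform hypergraph without long Berge paths has few edges. -/
theorem card_le_of_not_hasPath [Fintype V] (hN : ∀ e ∈ H, (N e).card = s)
    (hinj : Set.InjOn N H) (hs : 2 ≤ s) {p : ℕ} (hp : 1 ≤ p)
    (hno : ¬ HasPath N H p) {γ : ℝ}
    (hdeg : ∀ x y : ℕ, 2 * (x + y) + 1 ≤ p → (x : ℝ) + y.choose (s - 1) ≤ γ)
    (hsmall : ∀ m ≤ p, (m.choose 2 : ℝ) ≤ γ * m ∧ (m.choose s : ℝ) ≤ γ * m) :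
    (H.card : ℝ) ≤ γ * Fintype.card V := by
  rcases H.eq_empty_or_nonempty with rfl | hH
  · have h0 : (0 : ℝ) ≤ γ := le_trans (by positivity) (hdeg 0 0 (by omega))
    simp only [Finset.card_empty, Nat.cast_zero]
    positivity
  obtain ⟨B, hB, Rd, m, hRd, hdisj, hcard, hm, hmH⟩ := exists_red_blue N hH
  set Bl := B.biUnion fun e => (N e).powersetCard 2 with hBl
  have hpath : ∀ l : List V, l.IsChain (PairAdj Rd Bl) → l.Nodup → l.length ≤ p := by
    intro l hl hnd
    by_contra! hlen
    have hlen' : (l.take (p + 1)).length = p + 1 := by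
      rw [List.length_take]
      omega
    obtain ⟨es, hw, hes, hesH⟩ := exists_walk_of_chain hm hmH (l.take (p + 1))
      (by rintro h; rw [h] at hlen'; simp at hlen') (hl.take _) (hnd.sublist (List.take_sublist _ _))
    have := hw.length_eq
    exact hno ⟨_, es, hw, hnd.sublist (List.take_sublist _ _), hes, by omega,
      fun e he => (hesH e he).1⟩
  have h1 := weight_le hRd hdisj hs hpath hdeg hsmall Finset.univ
  have h2 : B.card ≤ (cliquesIn s Bl Finset.univ).card := by
    rw [← Finset.card_image_of_injOn (hinj.mono (Finset.coe_subset.2 hB))]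
    refine Finset.card_le_card fun S hS => ?_
    obtain ⟨e, he, rfl⟩ := Finset.mem_image.1 hS
    rw [cliquesIn, Finset.mem_filter, Finset.mem_powersetCard]
    exact ⟨⟨Finset.subset_univ _, hN e (hB he)⟩,
      fun q hq => Finset.mem_biUnion.2 ⟨e, he, hq⟩⟩
  have h3 : (redIn Rd Finset.univ).card = Rd.card := by simp [redIn]
  have h4 : (H \ B).card + B.card = H.card := Finset.card_sdiff_add_card_eq_card hB
  have h5 : (H.card : ℝ) = Rd.card + B.card := by
    rw [hcard]
    exact_mod_cast h4.symm
  have h2' : (B.card : ℝ) ≤ (cliquesIn s Bl Finset.univ).card := by exact_mod_cast h2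
  rw [h3, Finset.card_univ] at h1
  linarith

end RedBlue

/-! ### Connectors through the end of a maximal rainbow path -/

/-- A set of entries of a list that contains no two consecutive ones and not the last one. -/
theorem two_mul_countP_le {α : Type*} (d : α → Prop) [DecidablePred d] (l : List α)
    (hc : l.IsChain fun a b => ¬ (d a ∧ d b)) (hlast : ∀ a ∈ l.getLast?, ¬ d a) :
    2 * l.countP (fun a => d a) ≤ l.length := by
  induction hn : l.length using Nat.strong_induction_on generalizing l with
  | _ n ih =>
  cases l with
  | nil => simp
  | cons a t =>
    by_cases ha : d a
    · cases t with
      | nil => exact absurd ha (hlast a (by simp))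
      | cons b t =>
        rw [List.isChain_cons_cons] at hc
        have hb : ¬ d b := fun hb => hc.1 ⟨ha, hb⟩
        have := ih t.length (by simp at hn; omega) t (hc.2.of_cons) (by
          intro c hct
          cases t with
          | nil => simp at hct
          | cons e t => exact hlast c (by simpa using hct)) rfl
        rw [List.countP_cons_of_pos (by simpa using ha), List.countP_cons_of_neg (by simpa using hb)]
        simp at hn
        omega
    · have := ih t.length (by simp at hn; omega) t hc.of_cons (by
          intro c hct
          cases t with
          | nil => simp at hct
          | cons e t => exact hlast c (by simpa using hct)) rfl
      rw [List.countP_cons_of_neg (by simpa using ha)]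
      simp at hn
      omega

theorem card_edges_subset_le {n s : ℕ} (X : Finset (Edge n s)) (U : Finset (Fin n))
    (h : ∀ e ∈ X, e.1 ⊆ U) : X.card ≤ 2 ^ U.card := by
  rw [← Finset.card_powerset, ← Finset.card_image_of_injective X Subtype.val_injective]
  refine Finset.card_le_card fun e he => ?_
  obtain ⟨x, hx, rfl⟩ := Finset.mem_image.1 he
  exact Finset.mem_powerset.2 (h x hx)

theorem exists_edge_superset {n s : ℕ} (hn : s ≤ n) (T : Finset (Fin n)) (hT : T.card ≤ s) :
    ∃ e : Edge n s, T ⊆ e.1 := by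
  obtain ⟨e, he, -, hc⟩ := Finset.exists_subsuperset_card_eq (Finset.subset_univ T) hT (by simpa)
  exact ⟨⟨e, hc⟩, he⟩

theorem exists_edge_of_three {n s : ℕ} (hs : 3 ≤ s) (hn : s ≤ n) (a b c : Fin n) :
    ∃ e : Edge n s, a ∈ e.1 ∧ b ∈ e.1 ∧ c ∈ e.1 := by
  obtain ⟨e, he⟩ := exists_edge_superset hn {a, b, c} (Finset.card_le_three.trans hs)
  exact ⟨e, he (by simp), he (by simp), he (by simp)⟩

/-- The vertices `vs` and edges `es` form a rainbow Berge path. -/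
structure IsRainbowPath {n s : ℕ} {C : Type*} (φ : Edge n s → C) (vs : List (Fin n))
    (es : List (Edge n s)) : Prop where
  walk : Walk (fun v e => v ∈ e.1) vs es
  nodup : vs.Nodup
  rainbow : (es.map φ).Nodup

section Extension

variable {n s : ℕ} {C : Type*} {φ : Edge n s → C} {p : ℕ}

/-- At an end of a rainbow path that cannot be prolonged, the edges leaving the path repeat its
colours. -/
theorem colour_mem_of_maximal {k : ℕ} (hno : ∀ vs es, IsRainbowPath φ vs es → es.length ≠ k + 1)
    {v : Fin n} {vs : List (Fin n)} {es : List (Edge n s)} (hP : IsRainbowPath φ (v :: vs) es)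
    (hlen : es.length = k) {e : Edge n s} (hv : v ∈ e.1) {x : Fin n} (hx : x ∈ e.1)
    (hxv : x ∉ v :: vs) : φ e ∈ es.map φ := by
  by_contra he
  refine hno (x :: v :: vs) (e :: es) ⟨.cons hx hv hP.walk, List.nodup_cons.2 ⟨hxv, hP.nodup⟩, ?_⟩
    (by simpa using hlen)
  rw [List.map_cons, List.nodup_cons]
  exact ⟨he, hP.rainbow⟩

/-- The colours on `G` are distinct and avoid `L`, so a single connector with colour in `L` keeps a
path of `G`-edges rainbow. -/
theorem nodup_map_middle {G : Finset (Edge n s)} (hφ : Set.InjOn φ G) {L : List C}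
    (hL : ∀ e ∈ G, φ e ∉ L) {m₁ m₂ : List (Edge n s)} {f : Edge n s} (hf : φ f ∈ L)
    (hm : (m₁ ++ m₂).Nodup) (hG : ∀ e ∈ m₁ ++ m₂, e ∈ G) : ((m₁ ++ f :: m₂).map φ).Nodup := by
  rw [List.map_append, List.map_cons, List.nodup_middle, List.nodup_cons, ← List.map_append]
  refine ⟨fun h => ?_, ?_⟩
  · obtain ⟨e, he, hef⟩ := List.mem_map.1 h
    exact hL e (hG e he) (hef ▸ hf)
  · exact hm.map_on fun e he e' he' h => hφ (hG e he) (hG e' he') h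

variable {U : Finset (Fin n)} {v : Fin n} {L : List C} {G : Finset (Edge n s)}
  {vs : List (Fin n)} {es : List (Edge n s)}

/-- Otherwise a connector from the end of the path to `x`, followed by `h` from `x` to `y`, gives
length p + 2. -/
theorem mem_of_mem_outside_edge (hs : 3 ≤ s) (hn : s ≤ n)
    (hno : ∀ vs es, IsRainbowPath φ vs es → es.length ≠ p + 2)
    (hv : ∀ e : Edge n s, v ∈ e.1 → ∀ x ∈ e.1, x ∉ U → φ e ∈ L)
    (hφ : Set.InjOn φ G) (hL : ∀ e ∈ G, φ e ∉ L)
    (hw : Walk (fun v e => v ∈ e.1) vs es) (hvs : vs.Nodup) (hes : es.Nodup)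
    (hlen : es.length = p) (hG : ∀ e ∈ es, e ∈ G) {h : Edge n s} (hh : h ∈ G) (hhes : h ∉ es)
    {x : Fin n} (hx : x ∈ h.1) (hxU : x ∉ U) (hxvs : x ∉ vs) {y : Fin n} (hy : y ∈ h.1)
    (hyx : y ≠ x) : y ∈ vs := by
  by_contra hyvs
  have hne : vs ≠ [] := by
    rintro rfl
    cases hw
  obtain ⟨l, w, rfl⟩ := (List.eq_nil_or_concat vs).resolve_left hne
  rw [List.concat_eq_append] at *
  obtain ⟨f, hvf, hwf, hxf⟩ := exists_edge_of_three hs hn v w x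
  refine hno (l ++ w :: x :: [y]) (es ++ f :: [h])
    ⟨hw.append (.cons hx hy (.single y)) hwf hxf, ?_, ?_⟩ (by simp [hlen])
  · have : l ++ w :: x :: [y] = (l ++ [w]) ++ [x, y] := by simp
    rw [this, List.nodup_append]
    refine ⟨hvs, by simpa using hyx.symm, ?_⟩
    intro a ha b hb
    rcases List.mem_pair.1 hb with rfl | rfl
    · rintro rfl; exact hxvs ha
    · rintro rfl; exact hyvs ha
  · refine nodup_map_middle hφ hL (hv f hvf x hxf hxU) ?_ ?_
    · rw [List.nodup_append]
      exact ⟨hes, by simp, fun a ha b hb => by rintro rfl; exact hhes (List.mem_singleton.1 hb ▸ ha)⟩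
    · intro e he
      rcases List.mem_append.1 he with he | he
      · exact hG e he
      · exact List.mem_singleton.1 he ▸ hh

/-- Otherwise `h` leads from the end of the path to `x` and a connector from `x` to a new vertex,
giving length p + 2. The new vertex exists because the path and `x` use p + 2 < n vertices. -/
theorem getLast_notMem_outside_edge (hs : 3 ≤ s) (hn : s ≤ n) (hnp : p + 2 < n)
    (hno : ∀ vs es, IsRainbowPath φ vs es → es.length ≠ p + 2)
    (hv : ∀ e : Edge n s, v ∈ e.1 → ∀ x ∈ e.1, x ∉ U → φ e ∈ L)
    (hφ : Set.InjOn φ G) (hL : ∀ e ∈ G, φ e ∉ L)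
    (hw : Walk (fun v e => v ∈ e.1) vs es) (hvs : vs.Nodup) (hes : es.Nodup)
    (hlen : es.length = p) (hG : ∀ e ∈ es, e ∈ G) {h : Edge n s} (hh : h ∈ G) (hhes : h ∉ es)
    {x : Fin n} (hx : x ∈ h.1) (hxU : x ∉ U) (hxvs : x ∉ vs) :
    ∀ w ∈ vs.getLast?, w ∉ h.1 := by
  intro w hwl hwh
  obtain ⟨l, rfl⟩ := List.getLast?_eq_some_iff.1 hwl
  obtain ⟨z, hz⟩ : ∃ z, z ∉ (x :: (l ++ [w])).toFinset := by
    by_contra! hall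
    have h1 := Finset.card_le_card (fun z _ => hall z : Finset.univ ⊆ (x :: (l ++ [w])).toFinset)
    have h2 := List.toFinset_card_le (x :: (l ++ [w]))
    have h3 := hw.length_eq
    rw [Finset.card_univ, Fintype.card_fin] at h1
    rw [List.length_cons] at h2
    omega
  rw [List.mem_toFinset, List.mem_cons, not_or] at hz
  obtain ⟨f, hvf, hxf, hzf⟩ := exists_edge_of_three hs hn v x z
  refine hno (l ++ w :: x :: [z]) (es ++ h :: [f])
    ⟨hw.append (.cons hxf hzf (.single z)) hwh hx, ?_, ?_⟩ (by simp [hlen])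
  · have : l ++ w :: x :: [z] = (l ++ [w]) ++ [x, z] := by simp
    rw [this, List.nodup_append]
    refine ⟨hvs, by simpa using Ne.symm hz.1, ?_⟩
    intro a ha b hb
    rcases List.mem_pair.1 hb with rfl | rfl
    · rintro rfl; exact hxvs ha
    · rintro rfl; exact hz.2 ha
  · have : es ++ h :: [f] = (es ++ [h]) ++ f :: [] := by simp
    rw [this]
    refine nodup_map_middle hφ hL (hv f hvf x hxf hxU) ?_ ?_
    · rw [List.append_nil, List.nodup_append]
      exact ⟨hes, by simp, fun a ha b hb => by rintro rfl; exact hhes (List.mem_singleton.1 hb ▸ ha)⟩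
    · intro e he
      rw [List.append_nil] at he
      rcases List.mem_append.1 he with he | he
      · exact hG e he
      · exact List.mem_singleton.1 he ▸ hh

/-- The edge of the path between `a` and `b` is replaced by the detour `a`, `h`, `x`, connector,
`y`, `h'`, `b`, which is longer by two. -/
theorem false_of_consecutive (hs : 3 ≤ s) (hn : s ≤ n)
    (hno : ∀ vs es, IsRainbowPath φ vs es → es.length ≠ p + 2)
    (hv : ∀ e : Edge n s, v ∈ e.1 → ∀ x ∈ e.1, x ∉ U → φ e ∈ L)
    (hφ : Set.InjOn φ G) (hL : ∀ e ∈ G, φ e ∉ L) {l₁ l₂ : List (Fin n)} {a b : Fin n}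
    (hw : Walk (fun v e => v ∈ e.1) (l₁ ++ a :: b :: l₂) es) (hvs : (l₁ ++ a :: b :: l₂).Nodup)
    (hes : es.Nodup) (hlen : es.length = p) (hG : ∀ e ∈ es, e ∈ G)
    {h h' : Edge n s} (hh : h ∈ G) (hhes : h ∉ es) (hh' : h' ∈ G) (hhes' : h' ∉ es)
    {x y : Fin n} (hx : x ∈ h.1) (hxU : x ∉ U) (hxvs : x ∉ l₁ ++ a :: b :: l₂)
    (hy : y ∈ h'.1) (hyvs : y ∉ l₁ ++ a :: b :: l₂) (hxy : x ≠ y) (hne : h ≠ h')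
    (ha : a ∈ h.1) (hb : b ∈ h'.1) : False := by
  obtain ⟨f, hvf, hxf, hyf⟩ := exists_edge_of_three hs hn v x y
  obtain ⟨m₁, g, m₂, rfl, hw₁, hw₂⟩ := hw.split
  have hlen' : m₁.length + m₂.length + 1 = p := by
    rw [← hlen]
    simp
    omega
  refine hno (l₁ ++ a :: x :: y :: b :: l₂) (m₁ ++ h :: f :: h' :: m₂)
    ⟨hw₁.append (.cons hxf hyf (.cons hy hb hw₂)) ha hx, ?_, ?_⟩ (by simp; omega)
  · have e1 : (l₁ ++ a :: x :: y :: b :: l₂).Perm (x :: y :: (l₁ ++ a :: b :: l₂)) := by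
      have e2 : l₁ ++ a :: x :: y :: b :: l₂ = (l₁ ++ [a]) ++ ([x, y] ++ (b :: l₂)) := by simp
      have e3 : x :: y :: (l₁ ++ a :: b :: l₂) = [x, y] ++ ((l₁ ++ [a]) ++ b :: l₂) := by simp
      rw [e2, e3, ← List.append_assoc, ← List.append_assoc]
      exact (List.perm_append_comm).append_right _
    rw [e1.nodup_iff, List.nodup_cons, List.nodup_cons]
    exact ⟨by
      rw [List.mem_cons, not_or]
      exact ⟨hxy, hxvs⟩, hyvs, hvs⟩
  · have e1 : m₁ ++ h :: f :: h' :: m₂ = (m₁ ++ [h]) ++ f :: (h' :: m₂) := by simp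
    have e2 : (m₁ ++ [h]) ++ (h' :: m₂) = m₁ ++ h :: h' :: m₂ := by simp
    rw [List.nodup_middle, List.nodup_cons] at hes
    rw [List.mem_append, List.mem_cons] at hhes hhes'
    push Not at hhes hhes'
    rw [e1]
    refine nodup_map_middle hφ hL (hv f hvf x hxf hxU) ?_ ?_
    · rw [e2, List.nodup_middle, List.nodup_cons, List.nodup_middle, List.nodup_cons]
      simp only [List.mem_append, List.mem_cons, not_or]
      exact ⟨⟨hhes.1, hne, hhes.2.2⟩, ⟨hhes'.1, hhes'.2.2⟩, hes.2⟩
    · intro e he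
      rw [e2, List.mem_append, List.mem_cons, List.mem_cons] at he
      rcases he with he | rfl | rfl | he
      · exact hG e (by simp [he])
      · exact hh
      · exact hh'
      · exact hG e (by simp [he])

end Extension

/-! ### Counting the representative edges -/

section Counting

variable {n s : ℕ} {C : Type*} {φ : Edge n s → C} {p : ℕ}
  {U : Finset (Fin n)} {v : Fin n} {L : List C} {G : Finset (Edge n s)}
  {vs : List (Fin n)} {es : List (Edge n s)}

/-- The edges of a family that consist of one vertex outside `W` and `r` vertices in `D`. -/
theorem card_le_choose_mul (X : Finset (Edge n s)) (D : Finset (Fin n))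
    (h : ∀ e ∈ X, ∃ x ∈ e.1, e.1.erase x ⊆ D) : X.card ≤ D.card.choose (s - 1) * n := by
  have h1 : X.image Subtype.val ⊆
      (D.powersetCard (s - 1) ×ˢ (Finset.univ : Finset (Fin n))).image fun q => insert q.2 q.1 := by
    intro e he
    obtain ⟨e, he', rfl⟩ := Finset.mem_image.1 he
    obtain ⟨x, hx, hsub⟩ := h e he'
    refine Finset.mem_image.2 ⟨(e.1.erase x, x), ?_, Finset.insert_erase hx⟩
    rw [Finset.mem_product, Finset.mem_powersetCard, Finset.card_erase_of_mem hx, e.2]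
    exact ⟨⟨hsub, rfl⟩, Finset.mem_univ _⟩
  rw [← Finset.card_image_of_injective X Subtype.val_injective]
  refine (Finset.card_le_card h1).trans (Finset.card_image_le.trans ?_)
  rw [Finset.card_product, Finset.card_powersetCard, Finset.card_univ, Fintype.card_fin]

theorem card_le_of_walk (hs : 3 ≤ s) (hn : s ≤ n) (hnp : p + 2 < n)
    (hno : ∀ vs es, IsRainbowPath φ vs es → es.length ≠ p + 2)
    (hv : ∀ e : Edge n s, v ∈ e.1 → ∀ x ∈ e.1, x ∉ U → φ e ∈ L)
    (hφ : Set.InjOn φ G) (hL : ∀ e ∈ G, φ e ∉ L)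
    (hw : Walk (fun v e => v ∈ e.1) vs es) (hvs : vs.Nodup) (hes : es.Nodup)
    (hlen : es.length = p) (hG : ∀ e ∈ es, e ∈ G) :
    G.card ≤ (p / 2).choose (s - 1) * n + (p + 1) * 2 ^ (p + 2) + p + 2 ^ (U.card + p + 1) := by
  classical
  set W := vs.toFinset with hW
  have hWcard : W.card ≤ p + 1 := by
    rw [← hlen, ← hw.length_eq]
    exact List.toFinset_card_le vs
  set R := G.filter fun h => h ∉ es ∧ ∃ x ∈ h.1, x ∉ U ∧ x ∉ vs with hR
  have hmemR : ∀ h ∈ R, h ∈ G ∧ h ∉ es ∧ ∃ x ∈ h.1, x ∉ U ∧ x ∉ vs := fun h hh =>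
    Finset.mem_filter.1 hh
  have hsub : ∀ h ∈ R, ∀ x ∈ h.1, x ∉ U → x ∉ vs → ∀ y ∈ h.1, y ≠ x → y ∈ vs := by
    intro h hh x hx hxU hxvs y hy hyx
    obtain ⟨h1, h2, -⟩ := hmemR h hh
    exact mem_of_mem_outside_edge hs hn hno hv hφ hL hw hvs hes hlen hG h1 h2 hx hxU hxvs hy hyx
  -- `d w` means that `w` lies in edges of `R` with two different outside vertices. Two are needed
  -- so that, for consecutive path vertices, the outside vertices of the detour can be chosen
  -- distinct.
  let d : Fin n → Prop := fun w => ∃ h ∈ R, ∃ h' ∈ R, ∃ x ∈ h.1, ∃ y ∈ h'.1,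
    x ∉ U ∧ x ∉ vs ∧ y ∉ U ∧ y ∉ vs ∧ x ≠ y ∧ w ∈ h.1 ∧ w ∈ h'.1
  set D := W.filter d with hD
  have hDhead : ∀ w ∈ vs.head?, ¬ d w := by
    rintro w hw' ⟨h, hh, -, -, x, hx, -, -, hxU, hxvs, -, -, -, hwh, -⟩
    obtain ⟨h1, h2, -⟩ := hmemR h hh
    exact getLast_notMem_outside_edge hs hn hnp hno hv hφ hL hw.reverse (by simpa using hvs)
      (by simpa using hes) (by simpa using hlen) (fun e he => hG e (by simpa using he)) h1
      (by simpa using h2) hx hxU (by simpa using hxvs) w (by simpa using hw') hwh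
  have hDend : ∀ w ∈ vs.getLast?, ¬ d w := by
    rintro w hw' ⟨h, hh, -, -, x, hx, -, -, hxU, hxvs, -, -, -, hwh, -⟩
    obtain ⟨h1, h2, -⟩ := hmemR h hh
    exact getLast_notMem_outside_edge hs hn hnp hno hv hφ hL hw hvs hes hlen hG h1 h2 hx hxU hxvs
      w hw' hwh
  have hDchain : vs.IsChain fun a b => ¬ (d a ∧ d b) := by
    rw [List.isChain_iff_forall_rel_of_append_cons_cons]
    rintro a b l₁ l₂ hl ⟨⟨h, hh, -, -, x, hx, -, -, hxU, hxvs, -, -, -, hah, -⟩,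
      h₁, hh₁, h₂, hh₂, y, hy, z, hz, hyU, hyvs, hzU, hzvs, hyz, hbh₁, hbh₂⟩
    have key : ∀ h' ∈ R, ∀ y ∈ h'.1, y ∉ U → y ∉ vs → b ∈ h'.1 → x ≠ y → False := by
      intro h' hh' y hy hyU hyvs hbh' hxy
      obtain ⟨k1, k2, -⟩ := hmemR h hh
      obtain ⟨k3, k4, -⟩ := hmemR h' hh'
      have hne : h ≠ h' := by
        rintro rfl
        exact hyvs (hsub h hh x hx hxU hxvs y hy hxy.symm)
      subst hl
      exact false_of_consecutive hs hn hno hv hφ hL hw hvs hes hlen hG k1 k2 k3 k4 hx hxU hxvs hy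
        hyvs hxy hne hah hbh'
    by_cases hxy : x = y
    · exact key h₂ hh₂ z hz hzU hzvs hbh₂ (hxy ▸ hyz)
    · exact key h₁ hh₁ y hy hyU hyvs hbh₁ hxy
  -- `D` avoids both ends of a path with p + 1 vertices and contains no two consecutive vertices.
  have hDcard : D.card ≤ p / 2 := by
    have h1 : D.card ≤ vs.countP fun w => d w := by
      rw [List.countP_eq_length_filter]
      refine le_trans (Finset.card_le_card ?_) (List.toFinset_card_le _)
      intro w hw'
      simpa [hD, hW] using hw'
    have h2 := hw.length_eq
    cases vs with
    | nil => cases hw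
    | cons a t =>
      rw [List.countP_cons_of_neg (by simpa using hDhead a rfl)] at h1
      have h3 := two_mul_countP_le d t hDchain.of_cons (by
        intro c hc
        cases t with
        | nil => simp at hc
        | cons e t => exact hDend c (by simpa using hc))
      rw [List.length_cons] at h2
      omega
  -- At a path vertex without property `d`, all edges of `R` share one outside vertex x, so they lie
  -- in the bounded set `insert x W`.
  have hbad : (R.filter fun h => ∃ w ∈ W, w ∈ h.1 ∧ ¬ d w).card ≤ (p + 1) * 2 ^ (p + 2) := by
    have h1 : (R.filter fun h => ∃ w ∈ W, w ∈ h.1 ∧ ¬ d w) ⊆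
        (W.filter fun w => ¬ d w).biUnion fun w => R.filter fun h => w ∈ h.1 := by
      intro h hh
      rw [Finset.mem_filter] at hh
      obtain ⟨hh, w, hw', hwh, hdw⟩ := hh
      exact Finset.mem_biUnion.2
        ⟨w, Finset.mem_filter.2 ⟨hw', hdw⟩, Finset.mem_filter.2 ⟨hh, hwh⟩⟩
    refine (Finset.card_le_card h1).trans ((Finset.card_biUnion_le_card_mul _ _ (2 ^ (p + 2))
      ?_).trans (Nat.mul_le_mul_right _ ((Finset.card_filter_le _ _).trans hWcard)))
    intro w hw'
    rw [Finset.mem_filter] at hw'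
    rcases (R.filter fun h => w ∈ h.1).eq_empty_or_nonempty with h0 | ⟨h₀, hh₀⟩
    · rw [h0]
      simp
    rw [Finset.mem_filter] at hh₀
    obtain ⟨-, -, x, hx, hxU, hxvs⟩ := hmemR h₀ hh₀.1
    refine (card_edges_subset_le _ (insert x W) ?_).trans (Nat.pow_le_pow_right (by norm_num)
      ((Finset.card_insert_le _ _).trans (by omega)))
    intro h hh y hy
    rw [Finset.mem_filter] at hh
    obtain ⟨-, -, z, hz, hzU, hzvs⟩ := hmemR h hh.1
    have hzx : x = z := by
      by_contra hxz
      exact hw'.2 ⟨h₀, hh₀.1, h, hh.1, x, hx, z, hz, hxU, hxvs, hzU, hzvs, hxz, hh₀.2, hh.2⟩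
    subst hzx
    by_cases hyx : y = x
    · exact hyx ▸ Finset.mem_insert_self _ _
    · exact Finset.mem_insert_of_mem (List.mem_toFinset.2 (hsub h hh.1 x hz hzU hzvs y hy hyx))
  have hgood : (R.filter fun h => ¬ ∃ w ∈ W, w ∈ h.1 ∧ ¬ d w).card ≤
      (p / 2).choose (s - 1) * n := by
    refine (card_le_choose_mul _ D ?_).trans
      (Nat.mul_le_mul_right _ (Nat.choose_le_choose _ hDcard))
    intro h hh
    rw [Finset.mem_filter] at hh
    obtain ⟨hh, hh'⟩ := hh
    push Not at hh'
    obtain ⟨-, -, x, hx, hxU, hxvs⟩ := hmemR h hh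
    refine ⟨x, hx, fun y hy => ?_⟩
    rw [Finset.mem_erase] at hy
    have hyW : y ∈ W := List.mem_toFinset.2 (hsub h hh x hx hxU hxvs y hy.2 hy.1)
    exact Finset.mem_filter.2 ⟨hyW, hh' y hyW hy.2⟩
  have hRcard : R.card ≤ (p / 2).choose (s - 1) * n + (p + 1) * 2 ^ (p + 2) := by
    rw [← Finset.card_filter_add_card_filter_not (s := R) fun h => ∃ w ∈ W, w ∈ h.1 ∧ ¬ d w]
    omega
  have hinner : (G.filter fun h => h.1 ⊆ U ∪ W).card ≤ 2 ^ (U.card + p + 1) := by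
    refine (card_edges_subset_le _ (U ∪ W) fun e he => (Finset.mem_filter.1 he).2).trans
      (Nat.pow_le_pow_right (by norm_num) ((Finset.card_union_le _ _).trans (by omega)))
  have hcover : G ⊆ R ∪ es.toFinset ∪ G.filter fun h => h.1 ⊆ U ∪ W := by
    intro h hh
    simp only [Finset.mem_union, List.mem_toFinset, Finset.mem_filter, hR]
    by_cases h1 : h ∈ es
    · exact Or.inl (Or.inr h1)
    by_cases h2 : h.1 ⊆ U ∪ W
    · exact Or.inr ⟨hh, h2⟩
    · obtain ⟨x, hx, hxn⟩ := Finset.not_subset.1 h2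
      rw [Finset.mem_union, not_or, hW, List.mem_toFinset] at hxn
      exact Or.inl (Or.inl ⟨hh, h1, x, hx, hxn⟩)
  have h1 := Finset.card_le_card hcover
  have h2 := Finset.card_union_le (R ∪ es.toFinset) (G.filter fun h => h.1 ⊆ U ∪ W)
  have h3 := Finset.card_union_le R es.toFinset
  have h4 := List.toFinset_card_le es
  omega

/-- Suppose that the longest rainbow paths have `p + 1` edges. Then, up to a constant, either the
colours are the edges of a hypergraph with no Berge path of length `p`, or there are at most
`(p / 2).choose (s - 1) * n` of them. -/
theorem exists_hypergraph_or_card_le {c : ℕ} {φ : Edge n s → Fin c} (hsurj : Function.Surjective φ)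
    (hs : 3 ≤ s) (hn : s ≤ n) (hnp : p + 2 < n)
    (hno : ∀ vs es, IsRainbowPath φ vs es → es.length ≠ p + 2)
    {vs : List (Fin n)} {es : List (Edge n s)} (hP : IsRainbowPath φ vs es)
    (hlen : es.length = p + 1) :
    (∃ G : Finset (Edge n s), c ≤ G.card + (p + 1 + 2 ^ (p + 2)) ∧
      ¬ HasPath (fun e : Edge n s => e.1) G p) ∨
    c ≤ (p / 2).choose (s - 1) * n +
      ((p + 1) * 2 ^ (p + 2) + p + 2 ^ (2 * p + 3) + (p + 1 + 2 ^ (p + 2))) := by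
  classical
  cases vs with
  | nil => cases hP.walk
  | cons v vs =>
  set U := (v :: vs).toFinset with hU
  have hUcard : U.card ≤ p + 2 := by
    refine (List.toFinset_card_le _).trans ?_
    rw [hP.walk.length_eq, hlen]
  set L := es.map φ with hL
  have hv : ∀ e : Edge n s, v ∈ e.1 → ∀ x ∈ e.1, x ∉ U → φ e ∈ L := by
    intro e hve x hx hxU
    exact colour_mem_of_maximal (k := p + 1) hno hP hlen hve hx (by simpa [hU] using hxU)
  -- One representative edge per colour; `G` keeps those whose colours are not on the path.
  let r := Function.surjInv hsurj
  have hr : ∀ i, φ (r i) = i := Function.surjInv_eq hsurj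
  have hrinj : Function.Injective r := Function.injective_surjInv hsurj
  let I : Finset (Fin c) := Finset.univ.filter fun i => i ∉ L
  let G := I.image r
  -- Only the p + 1 colours of the path are lost; the term 2 ^ (p + 2) is slack.
  have hGcard : c ≤ G.card + (p + 1 + 2 ^ (p + 2)) := by
    rw [Finset.card_image_of_injective _ hrinj]
    have h1 : (Finset.univ : Finset (Fin c)) ⊆ I ∪ L.toFinset := by
      intro i _
      by_cases hi : i ∈ L <;> simp [I, hi]
    have h2 := (Finset.card_le_card h1).trans (Finset.card_union_le _ _)
    have h3 := List.toFinset_card_le L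
    rw [Finset.card_univ, Fintype.card_fin] at h2
    have h4 : L.length = p + 1 := by rw [hL, List.length_map, hlen]
    have h5 : 0 < 2 ^ (p + 2) := by positivity
    omega
  have hφ : Set.InjOn φ G := by
    intro e he e' he' h
    obtain ⟨i, -, rfl⟩ := Finset.mem_image.1 (Finset.mem_coe.1 he)
    obtain ⟨j, -, rfl⟩ := Finset.mem_image.1 (Finset.mem_coe.1 he')
    rw [hr, hr] at h
    rw [h]
  have hGL : ∀ e ∈ G, φ e ∉ L := by
    intro e he
    obtain ⟨i, hi, rfl⟩ := Finset.mem_image.1 he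
    rw [hr]
    exact (Finset.mem_filter.1 hi).2
  by_cases hpath : HasPath (fun e : Edge n s => e.1) G p
  · right
    obtain ⟨ws, gs, hw, hws, hgs, hgl, hgG⟩ := hpath
    have h1 := card_le_of_walk hs hn hnp hno hv hφ hGL hw hws hgs hgl hgG
    have h2 : 2 ^ (U.card + p + 1) ≤ 2 ^ (2 * p + 3) :=
      Nat.pow_le_pow_right (by norm_num) (by omega)
    omega
  · exact Or.inl ⟨G, hGcard, hpath⟩

end Counting

/-! ### Constructions for the lower bounds -/

section Lower

variable {n s k : ℕ}

/-- If every member of the family has two edges outside `H`, then colouring the edges of `H`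
differently and all others alike gives no rainbow member. -/
theorem card_lt_antiRamsey {F : Set (Set (Edge n s))} (H : Finset (Edge n s))
    (h : ∀ P ∈ F, ∃ e ∈ P, ∃ e' ∈ P, e ≠ e' ∧ e ∉ H ∧ e' ∉ H) : H.card < antiRamsey n s F := by
  classical
  obtain ⟨h1, hc⟩ := antiRamsey_mem n s F
  set c := antiRamsey n s F
  by_contra! hle
  let ι : H ≃ Fin H.card := H.equivFin
  -- The minimum merges surplus edges of `H` into the last colour, so that exactly `c` colours
  -- occur. Edges outside `H` share colour 0.
  let φ : Edge n s → Fin c := fun e =>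
    if he : e ∈ H then ⟨min (ι ⟨e, he⟩) (c - 1), by omega⟩ else ⟨0, by omega⟩
  obtain ⟨P, hP, hrain⟩ := hc φ (by
    intro i
    refine ⟨(ι.symm ⟨i, by omega⟩).1, ?_⟩
    have hmem := (ι.symm ⟨i.1, by omega⟩).2
    simp only [φ, dif_pos hmem, Subtype.coe_eta, Equiv.apply_symm_apply]
    ext
    simp only
    omega)
  obtain ⟨e, he, e', he', hne, heH, heH'⟩ := h P hP
  exact hne (hrain he he' (by simp only [φ, dif_neg heH, dif_neg heH']))

/-- A path on which no single index accounts for all edges outside `H` has two such edges, as the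
colouring argument needs. -/
theorem card_lt_antiRamsey_bergePaths (hk : 1 ≤ k) (H : Finset (Edge n s))
    (h : ∀ (e : Fin k → Edge n s) (v : Fin (k + 1) → Fin n), Function.Injective e →
      Function.Injective v → (∀ i : Fin k, v i.castSucc ∈ (e i).1 ∧ v i.succ ∈ (e i).1) →
      ∀ i₀ : Fin k, ¬ ∀ i, i ≠ i₀ → e i ∈ H) :
    H.card < antiRamsey n s (bergePaths n s k) := by
  refine card_lt_antiRamsey H ?_
  rintro P ⟨e, v, he, hv, hev, rfl⟩
  obtain ⟨i, hi, hiH⟩ : ∃ i, i ≠ (⟨0, hk⟩ : Fin k) ∧ e i ∉ H := by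
    have := h e v he hv hev ⟨0, hk⟩
    push Not at this
    exact this
  obtain ⟨j, hj, hjH⟩ : ∃ j, j ≠ i ∧ e j ∉ H := by
    have := h e v he hv hev i
    push Not at this
    exact this
  exact ⟨e i, ⟨i, rfl⟩, e j, ⟨j, rfl⟩, fun hij => hj (he hij).symm, hiH, hjH⟩

/-- The lower bound from the edges with exactly one vertex outside a fixed set of `a` vertices. -/
theorem choose_mul_lt_antiRamsey {a : ℕ} (hs : 1 ≤ s) (ha : 2 * a + 2 ≤ k) (han : a ≤ n) :
    a.choose (s - 1) * (n - a) < antiRamsey n s (bergePaths n s k) := by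
  classical
  let A : Finset (Fin n) := Finset.univ.filter fun i => i.1 < a
  have hA : A.card = a := by
    rw [Fin.card_filter_val_lt]
    exact min_eq_right han
  let H : Finset (Edge n s) := Finset.univ.filter fun e => (e.1 \ A).card = 1
  have hHcard : a.choose (s - 1) * (n - a) ≤ H.card := by
    have h1 : (A.powersetCard (s - 1) ×ˢ Aᶜ).card = a.choose (s - 1) * (n - a) := by
      rw [Finset.card_product, Finset.card_powersetCard, Finset.card_compl, hA, Fintype.card_fin]
    rw [← h1, ← Finset.card_image_of_injective H Subtype.val_injective]
    have hmem : ∀ q ∈ A.powersetCard (s - 1) ×ˢ Aᶜ, q.1 ⊆ A ∧ q.1.card = s - 1 ∧ q.2 ∉ A := by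
      intro q hq
      rw [Finset.mem_product, Finset.mem_powersetCard, Finset.mem_compl] at hq
      exact ⟨hq.1.1, hq.1.2, hq.2⟩
    have hsd : ∀ q ∈ A.powersetCard (s - 1) ×ˢ Aᶜ, insert q.2 q.1 \ A = {q.2} := by
      intro q hq
      obtain ⟨h2, -, h4⟩ := hmem q hq
      ext x
      simp only [Finset.mem_sdiff, Finset.mem_insert, Finset.mem_singleton]
      constructor
      · rintro ⟨rfl | hx, hxA⟩
        · rfl
        · exact absurd (h2 hx) hxA
      · rintro rfl
        exact ⟨Or.inl rfl, h4⟩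
    have hin : ∀ q ∈ A.powersetCard (s - 1) ×ˢ Aᶜ, insert q.2 q.1 ∩ A = q.1 := by
      intro q hq
      obtain ⟨h2, -, h4⟩ := hmem q hq
      rw [Finset.insert_inter_of_notMem h4, Finset.inter_eq_left.2 h2]
    refine Finset.card_le_card_of_injOn (fun q => insert q.2 q.1) ?_ ?_
    · intro q hq
      obtain ⟨h2, h3, h4⟩ := hmem q hq
      refine Finset.mem_coe.2 (Finset.mem_image.2 ⟨⟨insert q.2 q.1, ?_⟩, ?_, rfl⟩)
      · rw [Finset.card_insert_of_notMem fun h => h4 (h2 h), h3]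
        omega
      · rw [Finset.mem_filter]
        refine ⟨Finset.mem_univ _, ?_⟩
        simp only
        rw [hsd q hq, Finset.card_singleton]
    · intro q hq q' hq' h
      simp only at h
      refine Prod.ext ?_ ?_
      · rw [← hin q hq, ← hin q' hq', h]
      · rw [← Finset.singleton_inj, ← hsd q hq, ← hsd q' hq', h]
  refine lt_of_le_of_lt hHcard (card_lt_antiRamsey_bergePaths (by omega) H ?_)
  intro e v he hv hev i₀ hi₀
  let J : Finset (Fin (k + 1)) := Finset.univ.filter fun i => v i ∈ A
  let O : Finset (Fin (k + 1)) := Finset.univ.filter fun i => ¬ v i ∈ A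
  have hJ : J.card ≤ a := by
    rw [← hA]
    exact Finset.card_le_card_of_injOn v (fun i hi => (Finset.mem_filter.1 hi).2) hv.injOn
  -- An edge of `H` has only one vertex outside `A`, so an outside vertex is followed by one in `A`,
  -- except at the edge `i₀` and at the end of the path. Hence k + 1 ≤ 2a + 2, a contradiction.
  have hO : O ⊆ insert i₀.castSucc (insert (Fin.last k)
      (J.image fun i => (⟨i.1 - 1, by omega⟩ : Fin (k + 1)))) := by
    intro i hi
    rw [Finset.mem_insert, Finset.mem_insert, Finset.mem_image]
    induction i using Fin.lastCases with
    | last => exact Or.inr (Or.inl rfl)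
    | cast j =>
    have hj := hi
    by_cases hji : j = i₀
    · exact Or.inl (by rw [hji])
    refine Or.inr (Or.inr ⟨j.succ, ?_, by ext; simp⟩)
    rw [Finset.mem_filter]
    refine ⟨Finset.mem_univ _, ?_⟩
    by_contra hjA
    obtain ⟨x, hx⟩ := Finset.card_eq_one.1 (Finset.mem_filter.1 (hi₀ j hji)).2
    have h1 : v j.castSucc ∈ (e j).1 \ A :=
      Finset.mem_sdiff.2 ⟨(hev j).1, (Finset.mem_filter.1 hj).2⟩
    have h2 : v j.succ ∈ (e j).1 \ A := Finset.mem_sdiff.2 ⟨(hev j).2, hjA⟩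
    rw [hx, Finset.mem_singleton] at h1 h2
    have := congrArg Fin.val (hv (h1.trans h2.symm))
    simp at this
  have h1 := (Finset.card_le_card hO).trans ((Finset.card_insert_le _ _).trans
    (Nat.add_le_add_right ((Finset.card_insert_le _ _).trans
      (Nat.add_le_add_right Finset.card_image_le _)) _))
  have h2 : J.card + O.card = k + 1 := by
    rw [Finset.card_filter_add_card_filter_not, Finset.card_univ, Fintype.card_fin]
  omega

/-- The lower bound from `t` edges that have a set of `c` vertices in common and are otherwise
disjoint. -/
theorem lt_antiRamsey_of_sunflower {c w t : ℕ} (hw : 1 ≤ w) (hcw : c + w = s) (hck : c + 4 ≤ k)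
    (hn : c + w * t ≤ n) : t < antiRamsey n s (bergePaths n s k) := by
  classical
  have hbound : ∀ j : Fin t, ∀ m ∈ Finset.range c ∪ Finset.Ico (c + w * j) (c + w * (j + 1)),
      m < n := by
    intro j m hm
    have : w * (j + 1) ≤ w * t := Nat.mul_le_mul_left _ j.2
    rw [Finset.mem_union, Finset.mem_range, Finset.mem_Ico] at hm
    omega
  let f : Fin t → Edge n s := fun j =>
    ⟨(Finset.range c ∪ Finset.Ico (c + w * j) (c + w * (j + 1))).attachFin (hbound j), by
      rw [Finset.card_attachFin, Finset.card_union_of_disjoint, Finset.card_range, Nat.card_Ico,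
        mul_add]
      · omega
      · rw [Finset.disjoint_left]
        intro x hx hx'
        rw [Finset.mem_range] at hx
        rw [Finset.mem_Ico] at hx'
        omega⟩
  have hf : ∀ j (x : Fin n), x ∈ (f j).1 ↔ x.1 < c ∨ c + w * j ≤ x.1 ∧ x.1 < c + w * (j + 1) := by
    intro j x
    simp only [f, Finset.mem_attachFin, Finset.mem_union, Finset.mem_range, Finset.mem_Ico]
  have hcommon : ∀ i j (x : Fin n), x ∈ (f i).1 → x ∈ (f j).1 → c ≤ x.1 → i = j := by
    intro i j x hi hj hx
    rw [hf] at hi hj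
    have h1 : (x.1 - c) / w = i := by
      refine Nat.div_eq_of_lt_le ?_ ?_ <;> rw [mul_comm] <;> omega
    have h2 : (x.1 - c) / w = j := by
      refine Nat.div_eq_of_lt_le ?_ ?_ <;> rw [mul_comm] <;> omega
    exact Fin.ext (h1.symm.trans h2)
  have hinj : Function.Injective f := by
    intro i j hij
    have hlt : w * (i + 1) ≤ w * t := Nat.mul_le_mul_left _ i.2
    have hmul : w * (i + 1 : ℕ) = w * i + w := by ring
    have hmem : (⟨c + w * i, by omega⟩ : Fin n) ∈ (f i).1 := by
      rw [hf]
      simp only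
      omega
    exact hcommon i j _ hmem (hij ▸ hmem) (by simp)
  have hcard : (Finset.univ.image f).card = t := by
    rw [Finset.card_image_of_injective _ hinj, Finset.card_univ, Fintype.card_fin]
  have key := card_lt_antiRamsey_bergePaths (k := k) (by omega) (Finset.univ.image f) ?_
  · rwa [hcard] at key
  intro e v he hv hev i₀ hi₀
  let A : Finset (Fin n) := Finset.univ.filter fun i => i.1 < c
  have hA : A.card ≤ c := by
    rw [Fin.card_filter_val_lt]
    exact min_le_right _ _
  -- `J` indexes the inner vertices whose two path edges both lie in `H`. Distinct petals are
  -- disjoint, so these vertices lie in the core, but there are at least k - 3 > c of them.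
  let J : Finset (Fin (k - 1)) := Finset.univ.filter fun j => j.1 ≠ i₀.1 ∧ j.1 + 1 ≠ i₀.1
  have hJ : k - 1 ≤ J.card + 2 := by
    have h1 : (Finset.univ : Finset (Fin (k - 1))) ⊆
        J ∪ ((Finset.univ.filter fun j => j.1 = i₀.1) ∪
          (Finset.univ.filter fun j => j.1 + 1 = i₀.1)) := by
      intro j _
      simp only [J, Finset.mem_union, Finset.mem_filter, Finset.mem_univ, true_and]
      tauto
    have h2 : (Finset.univ.filter fun j : Fin (k - 1) => j.1 = i₀.1).card ≤ 1 := by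
      rw [Finset.card_le_one]
      intro a ha b hb
      rw [Finset.mem_filter] at ha hb
      omega
    have h3 : (Finset.univ.filter fun j : Fin (k - 1) => j.1 + 1 = i₀.1).card ≤ 1 := by
      rw [Finset.card_le_one]
      intro a ha b hb
      rw [Finset.mem_filter] at ha hb
      omega
    have h4 := (Finset.card_le_card h1).trans ((Finset.card_union_le _ _).trans
      (Nat.add_le_add_left (Finset.card_union_le _ _) _))
    rw [Finset.card_univ, Fintype.card_fin] at h4
    omega
  have hJA : J.card ≤ A.card := by
    refine Finset.card_le_card_of_injOn (fun j => v ⟨j.1 + 1, by omega⟩) ?_ ?_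
    · intro j hj
      obtain ⟨-, h1, h2⟩ := Finset.mem_filter.1 hj
      obtain ⟨i, -, hi⟩ := Finset.mem_image.1
        (hi₀ ⟨j.1, by omega⟩ fun h => h1 (congrArg Fin.val h))
      obtain ⟨i', -, hi'⟩ := Finset.mem_image.1
        (hi₀ ⟨j.1 + 1, by omega⟩ fun h => h2 (congrArg Fin.val h))
      refine Finset.mem_filter.2 ⟨Finset.mem_univ _, ?_⟩
      by_contra hx
      have h3 : v ⟨j.1 + 1, by omega⟩ ∈ (f i).1 := hi ▸ (hev ⟨j.1, by omega⟩).2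
      have h4 : v ⟨j.1 + 1, by omega⟩ ∈ (f i').1 := hi' ▸ (hev ⟨j.1 + 1, by omega⟩).1
      have h5 := hcommon i i' _ h3 h4 (by simpa using hx)
      have h6 := he (hi.symm.trans ((congrArg f h5).trans hi'))
      simp at h6
    · intro i _ j _ hij
      have := hv hij
      simp only [Fin.mk.injEq] at this
      omega
  omega

/-- The lower bound from disjoint blocks of `s + 1` vertices with `t` edges in each of them. -/
theorem blocks_mul_lt_antiRamsey {t : ℕ} (hs : 1 ≤ s) (hts : t ≤ s + 1) (hk : 2 * t + 2 ≤ k) :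
    n / (s + 1) * t < antiRamsey n s (bergePaths n s k) := by
  classical
  have hbound : ∀ b : Fin (n / (s + 1)), ∀ j : Fin t,
      ∀ m ∈ (Finset.Ico ((s + 1) * b) ((s + 1) * (b + 1))).erase ((s + 1) * b + j), m < n := by
    intro b j m hm
    have h1 : (s + 1) * (b + 1) ≤ (s + 1) * (n / (s + 1)) := Nat.mul_le_mul_left _ b.2
    have h2 := Nat.mul_div_le n (s + 1)
    rw [Finset.mem_erase, Finset.mem_Ico] at hm
    omega
  let f : Fin (n / (s + 1)) → Fin t → Edge n s := fun b j =>
    ⟨((Finset.Ico ((s + 1) * b) ((s + 1) * (b + 1))).erase ((s + 1) * b + j)).attachFin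
      (hbound b j), by
      rw [Finset.card_attachFin, Finset.card_erase_of_mem, Nat.card_Ico, mul_add]
      · omega
      · rw [Finset.mem_Ico, mul_add]
        omega⟩
  have hf : ∀ b j (x : Fin n), x ∈ (f b j).1 ↔
      x.1 ≠ (s + 1) * b + j ∧ (s + 1) * b ≤ x.1 ∧ x.1 < (s + 1) * (b + 1) := by
    intro b j x
    simp only [f, Finset.mem_attachFin, Finset.mem_erase, Finset.mem_Ico]
  have hblock : ∀ b j (x : Fin n), x ∈ (f b j).1 → x.1 / (s + 1) = b := by
    intro b j x hx
    rw [hf] at hx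
    refine Nat.div_eq_of_lt_le ?_ ?_ <;> rw [mul_comm] <;> omega
  have hne : ∀ b j, ∃ x, x ∈ (f b j).1 := by
    intro b j
    exact Finset.card_pos.1 (by rw [(f b j).2]; exact hs)
  have hinj : Function.Injective fun q : Fin (n / (s + 1)) × Fin t => f q.1 q.2 := by
    rintro ⟨b, j⟩ ⟨b', j'⟩ h
    simp only at h
    obtain ⟨x, hx⟩ := hne b j
    obtain rfl : b = b' := Fin.ext ((hblock b j x hx).symm.trans (hblock b' j' x (h ▸ hx)))
    by_contra hjj
    have hjj' : j.1 ≠ j'.1 := fun h => hjj (by rw [Fin.ext h])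
    have h1 : (s + 1) * (b + 1) ≤ (s + 1) * (n / (s + 1)) := Nat.mul_le_mul_left _ b.2
    have h2 := Nat.mul_div_le n (s + 1)
    have h3 : (s + 1) * (b + 1 : ℕ) = (s + 1) * b + (s + 1) := by ring
    have hmem : (⟨(s + 1) * b + j, by omega⟩ : Fin n) ∈ (f b j').1 := by
      rw [hf]
      simp only
      omega
    rw [← h, hf] at hmem
    exact hmem.1 rfl
  let H := Finset.univ.image fun q : Fin (n / (s + 1)) × Fin t => f q.1 q.2
  have hcard : H.card = n / (s + 1) * t := by
    rw [Finset.card_image_of_injective _ hinj, Finset.card_univ, Fintype.card_prod,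
      Fintype.card_fin, Fintype.card_fin]
  have hH : ∀ e ∈ H, ∃ b j, f b j = e := by
    intro e he
    obtain ⟨q, -, hq⟩ := Finset.mem_image.1 he
    exact ⟨q.1, q.2, hq⟩
  have key := card_lt_antiRamsey_bergePaths (k := k) (by omega) H ?_
  · rwa [hcard] at key
  intro e v he hv hev i₀ hi₀
  -- Consecutive edges of `H` stay in one block, which has only `t` edges. The runs before and after
  -- `i₀` thus give k - 1 ≤ 2t.
  have hrun : ∀ a m : ℕ, ∀ ham : a + m ≤ k, (∀ i (hi : i < m), e ⟨a + i, by omega⟩ ∈ H) →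
      m ≤ t := by
    intro a m ham hm
    have hconst : ∀ i (hi : i ≤ m),
        (v ⟨a + i, by omega⟩).1 / (s + 1) = (v ⟨a, by omega⟩).1 / (s + 1) := by
      intro i
      induction i with
      | zero => intro _; rfl
      | succ i ih =>
        intro hi
        rw [← ih (by omega)]
        obtain ⟨b, j, hbj⟩ := hH _ (hm i (by omega))
        have h1 := hblock b j (v ⟨a + i, by omega⟩) (hbj ▸ (hev ⟨a + i, by omega⟩).1)
        have h2 := hblock b j (v ⟨a + (i + 1), by omega⟩) (hbj ▸ (hev ⟨a + i, by omega⟩).2)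
        rw [h1, h2]
    rcases Nat.eq_zero_or_pos m with rfl | hmpos
    · omega
    obtain ⟨b, j, hbj⟩ := hH _ (hm 0 hmpos)
    have hb : (v ⟨a, by omega⟩).1 / (s + 1) = b :=
      hblock b j _ (hbj ▸ (hev ⟨a + 0, by omega⟩).1)
    have h1 : (Finset.univ.image fun i : Fin m => e ⟨a + i, by omega⟩) ⊆
        Finset.univ.image (f b) := by
      intro x hx
      obtain ⟨i, -, rfl⟩ := Finset.mem_image.1 hx
      obtain ⟨b', j', hbj'⟩ := hH _ (hm i i.2)
      have h2 := hblock b' j' (v ⟨a + i, by omega⟩) (hbj' ▸ (hev ⟨a + i, by omega⟩).1)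
      rw [hconst i i.2.le, hb] at h2
      rw [← hbj', ← Fin.ext h2]
      exact Finset.mem_image_of_mem _ (Finset.mem_univ _)
    have h2 := (Finset.card_le_card h1).trans Finset.card_image_le
    rw [Finset.card_image_of_injective, Finset.card_univ, Finset.card_univ, Fintype.card_fin,
      Fintype.card_fin] at h2
    · exact h2
    · intro i i' hii
      have := he hii
      simp only [Fin.mk.injEq] at this
      omega
  have h1 := hrun 0 i₀ (by omega) (fun i hi => hi₀ _ fun h => by
    have := congrArg Fin.val h
    simp at this
    omega)
  have h2 := hrun (i₀ + 1) (k - 1 - i₀) (by omega) (fun i hi => hi₀ _ fun h => by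
    have := congrArg Fin.val h
    simp at this
    omega)
  omega

end Lower

/-! ### Inequalities between binomial coefficients -/

section Binomial

/-- Factor by factor, 2m - i ≥ 2(m - i). -/
theorem two_pow_mul_choose_le (m r : ℕ) : 2 ^ r * m.choose r ≤ (2 * m).choose r := by
  induction r with
  | zero => simp
  | succ r ih =>
    rcases lt_or_ge m r with h | h
    · rw [Nat.choose_eq_zero_of_lt (show m < r + 1 by omega)]
      simp
    refine Nat.le_of_mul_le_mul_right ?_ (Nat.succ_pos r)
    have h1 := Nat.choose_succ_right_eq m r
    have h2 := Nat.choose_succ_right_eq (2 * m) r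
    calc 2 ^ (r + 1) * m.choose (r + 1) * (r + 1)
        = 2 ^ (r + 1) * (m.choose (r + 1) * (r + 1)) := by ring
      _ = 2 ^ r * m.choose r * (2 * (m - r)) := by rw [h1]; ring
      _ ≤ (2 * m).choose r * (2 * m - r) := Nat.mul_le_mul ih (by omega)
      _ = (2 * m).choose (r + 1) * (r + 1) := h2.symm

theorem lt_two_pow_pred {s : ℕ} (hs : 3 ≤ s) : s < 2 ^ (s - 1) := by
  induction s, hs using Nat.le_induction with
  | base => norm_num
  | succ s hs ih =>
    rw [show s + 1 - 1 = (s - 1) + 1 by omega, pow_succ]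
    omega

/-- Halving the upper index loses a factor of at least 2 ^ (s - 1), which exceeds s. -/
theorem mul_choose_half_lt {s p q : ℕ} (hs : 3 ≤ s) (hpq : p ≤ q) (hq : s ≤ q) :
    s * (p / 2).choose (s - 1) < q.choose (s - 1) := by
  have hpos : 0 < q.choose (s - 1) := Nat.choose_pos (by omega)
  rcases Nat.eq_zero_or_pos ((p / 2).choose (s - 1)) with h | h
  · rw [h]
    simpa using hpos
  · calc s * (p / 2).choose (s - 1) < 2 ^ (s - 1) * (p / 2).choose (s - 1) :=
          Nat.mul_lt_mul_of_pos_right (lt_two_pow_pred hs) h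
      _ ≤ (2 * (p / 2)).choose (s - 1) := two_pow_mul_choose_le _ _
      _ ≤ q.choose (s - 1) := Nat.choose_le_choose _ (by omega)

theorem add_two_le_choose (j : ℕ) : j + 3 ≤ (j + 4).choose (j + 1) := by
  induction j with
  | zero => decide
  | succ j ih =>
    rw [Nat.choose_succ_succ']
    have : 0 < (j + 4).choose (j + 1 + 1) := Nat.choose_pos (by omega)
    omega

theorem mul_pred_lt_choose {s p : ℕ} (hs : 3 ≤ s) (hp : s + 1 ≤ p) :
    s * (p - 1) < 2 * p.choose (s - 1) := by
  induction p, hp using Nat.le_induction with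
  | base =>
    have h1 := Nat.choose_symm_of_eq_add (show s + 1 = (s - 1) + 2 by omega)
    rw [h1, Nat.choose_two_right, Nat.add_sub_cancel,
      Nat.mul_div_cancel' (even_iff_two_dvd.1 (by
        rw [mul_comm]
        exact Nat.even_mul_succ_self s))]
    nlinarith
  | succ p hp ih =>
    have h1 : (p + 1).choose (s - 1) = p.choose (s - 2) + p.choose (s - 1) := by
      rw [show s - 1 = (s - 2) + 1 by omega, Nat.choose_succ_succ']
    have h2 : s ≤ p.choose (s - 2) := by
      obtain ⟨j, rfl⟩ : ∃ j, s = j + 3 := ⟨s - 3, by omega⟩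
      calc j + 3 ≤ (j + 4).choose (j + 1) := add_two_le_choose j
        _ ≤ p.choose (j + 1) := Nat.choose_le_choose _ hp
        _ = p.choose (j + 3 - 2) := rfl
    have h3 : s * (p + 1 - 1) = s * (p - 1) + s := by
      obtain ⟨t, rfl⟩ : ∃ t, p = t + 1 := ⟨p - 1, by omega⟩
      simp only [Nat.add_sub_cancel]
      ring
    rw [h1, h3]
    omega

theorem choose_pred_lt {s p : ℕ} (hs : 2 ≤ s) (hp : s ≤ p) :
    (p - 1).choose (s - 1) < p.choose (s - 1) := by
  obtain ⟨q, rfl⟩ : ∃ q, p = q + 1 := ⟨p - 1, by omega⟩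
  obtain ⟨r, rfl⟩ : ∃ r, s = r + 2 := ⟨s - 2, by omega⟩
  have : 0 < q.choose r := Nat.choose_pos (by omega)
  rw [show r + 2 - 1 = r + 1 by omega, Nat.add_sub_cancel, Nat.choose_succ_succ']
  omega

theorem choose_mul_eq {s p : ℕ} (hs : 1 ≤ s) (hp : 1 ≤ p) :
    p.choose s * s = p * (p - 1).choose (s - 1) := by
  obtain ⟨q, rfl⟩ : ∃ q, p = q + 1 := ⟨p - 1, by omega⟩
  obtain ⟨r, rfl⟩ : ∃ r, s = r + 1 := ⟨s - 1, by omega⟩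
  exact (Nat.add_one_mul_choose_eq q r).symm

/-- `m.choose r / m` increases with `m`. -/
theorem mul_choose_le_mul_choose {m p r : ℕ} (hr : 1 ≤ r) (hmp : m ≤ p) :
    p * m.choose r ≤ m * p.choose r := by
  rcases Nat.eq_zero_or_pos m with rfl | hm
  · rw [Nat.choose_eq_zero_of_lt (by omega)]
    simp
  refine Nat.le_of_mul_le_mul_right ?_ hr
  calc p * m.choose r * r = p * (m.choose r * r) := by ring
    _ = p * m * (m - 1).choose (r - 1) := by rw [choose_mul_eq hr hm]; ring
    _ ≤ p * m * (p - 1).choose (r - 1) :=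
        Nat.mul_le_mul_left _ (Nat.choose_le_choose _ (by omega))
    _ = m * (p.choose r * r) := by rw [choose_mul_eq hr (by omega)]; ring
    _ = m * p.choose r * r := by ring

end Binomial

/-! ### The upper bounds -/

section Upper

/-- The coefficient of `n` in the upper bound. -/
noncomputable def rate (s k : ℕ) : ℝ :=
  if k ≤ s + 1 then ((k : ℝ) - 2) / ((s : ℝ) + 1) else ((k - 2).choose (s - 1) : ℝ) / s

theorem rate_pos {s k : ℕ} (hs : 3 ≤ s) (hk : 3 ≤ k) : 0 < rate s k := by
  rw [rate]
  split_ifs with h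
  · have : (3 : ℝ) ≤ k := by exact_mod_cast hk
    exact div_pos (by linarith) (by positivity)
  · have : 0 < (k - 2).choose (s - 1) := Nat.choose_pos (by omega)
    have : (0 : ℝ) < s := by exact_mod_cast (by omega : 0 < s)
    positivity

theorem choose_half_lt_rate {s k p : ℕ} (hs : 3 ≤ s) (hk : 3 ≤ k) (hp : p + 2 ≤ k) :
    ((p / 2).choose (s - 1) : ℝ) < rate s k := by
  by_cases h : k ≤ s + 1
  · rw [Nat.choose_eq_zero_of_lt (by omega), Nat.cast_zero]
    exact rate_pos hs hk
  · rw [rate, if_neg h, lt_div_iff₀ (by exact_mod_cast (by omega : 0 < s)), mul_comm]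
    exact_mod_cast mul_choose_half_lt hs (by omega : p ≤ k - 2) (by omega)

/-- The inequality γ < `rate s k` is strict because p ≤ k - 2, whereas for k ≥ s + 2 the rate is the
density C(k - 1, s)/(k - 1) of disjoint cliques on k - 1 vertices. The gap pays for additive
constants. -/
theorem exists_turan_rate {s k p : ℕ} (hs : 3 ≤ s) (hp : 1 ≤ p) (hpk : p + 2 ≤ k) :
    ∃ γ < rate s k, ∀ (n : ℕ) (G : Finset (Edge n s)),
      ¬ HasPath (fun e : Edge n s => e.1) G p → (G.card : ℝ) ≤ γ * n := by
  have hs0 : (0 : ℝ) < s := by exact_mod_cast (by omega : 0 < s)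
  by_cases hps : p ≤ s
  · refine ⟨((p : ℝ) - 1) / s, ?_, fun n G hG => ?_⟩
    · have hpk' : (p : ℝ) + 2 ≤ k := by exact_mod_cast hpk
      rw [rate]
      split_ifs with h
      · have hks : (k : ℝ) ≤ s + 1 := by exact_mod_cast h
        rw [div_lt_div_iff₀ hs0 (by positivity)]
        nlinarith
      · rw [div_lt_div_iff_of_pos_right hs0]
        have h1 : s.choose (s - 1) ≤ (k - 2).choose (s - 1) := Nat.choose_le_choose _ (by omega)
        rw [Nat.choose_symm (by omega : 1 ≤ s), Nat.choose_one_right] at h1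
        have h2 : (s : ℝ) ≤ (k - 2).choose (s - 1) := by exact_mod_cast h1
        have h3 : (p : ℝ) ≤ s := by exact_mod_cast hps
        linarith
    · have h := card_mul_le_of_not_hasPath (s := s) (fun e _ => e.2) Subtype.val_injective.injOn
        (by omega) hps hp hG
      rw [Fintype.card_fin] at h
      have h' : (G.card : ℝ) * s ≤ (p - 1) * n := by
        have : ((G.card * s : ℕ) : ℝ) ≤ ((p - 1) * n : ℕ) := by exact_mod_cast h
        rwa [Nat.cast_mul, Nat.cast_mul, Nat.cast_sub hp, Nat.cast_one] at this
      rw [div_mul_eq_mul_div, le_div_iff₀ hs0]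
      exact h'
  -- The two terms are the densities, per vertex, of all pairs and of all s-sets in a component with
  -- p vertices.
  · set γ : ℝ := max (((p : ℝ) - 1) / 2) (((p - 1).choose (s - 1) : ℝ) / s) with hγ
    have hp1 : (0 : ℝ) < (p : ℝ) - 1 := by
      have : (2 : ℝ) ≤ p := by exact_mod_cast (by omega : 2 ≤ p)
      linarith
    have hcast : ((p - 1 : ℕ) : ℝ) = (p : ℝ) - 1 := by
      rw [Nat.cast_sub hp, Nat.cast_one]
    have hγ0 : 0 ≤ γ := le_max_of_le_left (by positivity)
    refine ⟨γ, ?_, fun n G hG => ?_⟩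
    · rw [rate, if_neg (by omega)]
      have h0 : (p.choose (s - 1) : ℝ) / s ≤ ((k - 2).choose (s - 1) : ℝ) / s := by
        rw [div_le_div_iff_of_pos_right hs0]
        exact_mod_cast Nat.choose_le_choose _ (by omega)
      refine lt_of_lt_of_le (max_lt ?_ ?_) h0
      · have h1 : ((s * (p - 1) : ℕ) : ℝ) < (2 * p.choose (s - 1) : ℕ) := by
          exact_mod_cast mul_pred_lt_choose hs (by omega : s + 1 ≤ p)
        push_cast [hcast] at h1
        rw [div_lt_div_iff₀ two_pos hs0]
        linarith
      · rw [div_lt_div_iff_of_pos_right hs0]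
        exact_mod_cast choose_pred_lt (by omega) (by omega)
    · have h := card_le_of_not_hasPath (s := s) (γ := γ) (fun e _ => e.2)
        Subtype.val_injective.injOn (by omega) hp hG ?_ ?_
      · rwa [Fintype.card_fin] at h
      -- Both x ≤ γ · 2x/(p - 1) and C(y, s - 1) ≤ γ · 2y/(p - 1) hold, and 2(x + y) ≤ p - 1. The
      -- second uses s · C(y, s - 1) ≤ C(2y, s - 1) and the monotonicity of C(m, s - 1)/m.
      · intro x y hxy
        have h1 : (p - 1) * (2 * y).choose (s - 1) ≤ 2 * y * (p - 1).choose (s - 1) :=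
          mul_choose_le_mul_choose (by omega) (by omega)
        have h2 : s * y.choose (s - 1) ≤ (2 * y).choose (s - 1) :=
          (Nat.mul_le_mul_right _ (lt_two_pow_pred hs).le).trans (two_pow_mul_choose_le _ _)
        have h3 : (p - 1) * (s * y.choose (s - 1)) ≤ 2 * y * (p - 1).choose (s - 1) :=
          (Nat.mul_le_mul_left _ h2).trans h1
        have h4 : ((p : ℝ) - 1) * (s * y.choose (s - 1)) ≤ 2 * y * (p - 1).choose (s - 1) := by
          rw [← hcast]
          exact_mod_cast h3
        have h5 : ((p - 1).choose (s - 1) : ℝ) ≤ γ * s := by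
          rw [← div_le_iff₀ hs0]
          exact le_max_right _ _
        have h6 : ((p : ℝ) - 1) ≤ γ * 2 := by
          rw [← div_le_iff₀ two_pos]
          exact le_max_left _ _
        have h7 : ((p : ℝ) - 1) * y.choose (s - 1) ≤ 2 * y * γ := by
          refine le_of_mul_le_mul_right ?_ hs0
          have : (0 : ℝ) ≤ y := Nat.cast_nonneg _
          nlinarith
        have h8 : 2 * ((x : ℝ) + y) + 1 ≤ p := by exact_mod_cast hxy
        have h9 : (0 : ℝ) ≤ x := Nat.cast_nonneg _
        refine le_of_mul_le_mul_left ?_ hp1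
        nlinarith
      · intro m hm
        have hm0 : (0 : ℝ) ≤ m := Nat.cast_nonneg _
        have hmp : (m : ℝ) ≤ p := by exact_mod_cast hm
        constructor
        · rw [Nat.cast_choose_two]
          have h6 : ((p : ℝ) - 1) ≤ γ * 2 := by
            rw [← div_le_iff₀ two_pos]
            exact le_max_left _ _
          nlinarith
        · rcases Nat.eq_zero_or_pos m with rfl | hmpos
          · rw [Nat.choose_eq_zero_of_lt (by omega)]
            simp
          have h1 : m.choose s * s ≤ m * (p - 1).choose (s - 1) := by
            rw [choose_mul_eq (by omega) hmpos]
            exact Nat.mul_le_mul_left _ (Nat.choose_le_choose _ (by omega))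
          have h2 : (m.choose s : ℝ) * s ≤ m * (p - 1).choose (s - 1) := by exact_mod_cast h1
          have h5 : ((p - 1).choose (s - 1) : ℝ) ≤ γ * s := by
            rw [← div_le_iff₀ hs0]
            exact le_max_right _ _
          refine le_of_mul_le_mul_right ?_ hs0
          nlinarith

theorem IsRainbowPath.exists_mem_bergePaths {n s : ℕ} {C : Type*} {φ : Edge n s → C}
    {vs : List (Fin n)} {es : List (Edge n s)} (h : IsRainbowPath φ vs es) :
    ∃ P ∈ bergePaths n s es.length, IsRainbow φ P := by
  have hl := h.walk.length_eq
  have hes : es.Nodup := List.Nodup.of_map _ h.rainbow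
  refine ⟨Set.range fun i : Fin es.length => es[i],
    ⟨fun i => es[i], fun i => vs[i.1]'(by omega), ?_, ?_, ?_, rfl⟩, ?_⟩
  · intro i j hij
    exact Fin.ext (hes.getElem_inj_iff.1 hij)
  · intro i j hij
    exact Fin.ext (h.nodup.getElem_inj_iff.1 hij)
  · intro i
    exact h.walk.incident i i.2
  · rintro _ ⟨i, rfl⟩ _ ⟨j, rfl⟩ hij
    exact List.inj_on_of_nodup_map h.rainbow (List.getElem_mem _) (List.getElem_mem _) hij

/-- The least unattained length is p + 2: lengths 0 and 1 always occur, and by minimality p + 1 is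
attained. -/
theorem exists_maximal_rainbow {n s k : ℕ} {C : Type*} {φ : Edge n s → C} (hs : 3 ≤ s) (hn : s ≤ n)
    (hno : ∀ vs es, IsRainbowPath φ vs es → es.length ≠ k) :
    ∃ p, p + 2 ≤ k ∧ (∀ vs es, IsRainbowPath φ vs es → es.length ≠ p + 2) ∧
      ∃ vs es, IsRainbowPath φ vs es ∧ es.length = p + 1 := by
  classical
  have hex : ∃ m, ∀ vs es, IsRainbowPath φ vs es → es.length ≠ m := ⟨k, hno⟩
  let a : Fin n := ⟨0, by omega⟩
  let b : Fin n := ⟨1, by omega⟩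
  have hab : a ≠ b := by simp [a, b]
  obtain ⟨e, ha, hb, -⟩ := exists_edge_of_three hs hn a b b
  have h0 : Nat.find hex ≠ 0 := by
    intro h
    exact (h ▸ Nat.find_spec hex) [a] [] ⟨.single a, by simp, by simp⟩ rfl
  have h1 : Nat.find hex ≠ 1 := by
    intro h
    exact (h ▸ Nat.find_spec hex) [a, b] [e]
      ⟨.cons ha hb (.single b), by simpa using hab, by simp⟩ rfl
  obtain ⟨p, hp⟩ : ∃ p, Nat.find hex = p + 2 := ⟨Nat.find hex - 2, by omega⟩
  refine ⟨p, hp ▸ Nat.find_min' hex hno, hp ▸ Nat.find_spec hex, ?_⟩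
  have := Nat.find_min hex (show p + 1 < Nat.find hex by omega)
  push Not at this
  exact this

theorem exists_forall_le_of_lt {γ r : ℝ} (h : γ < r) (K : ℝ) :
    ∃ N : ℕ, ∀ n : ℕ, N ≤ n → γ * n + K ≤ r * n := by
  obtain ⟨N, hN⟩ := exists_nat_ge (K / (r - γ))
  refine ⟨N, fun n hn => ?_⟩
  rw [div_le_iff₀ (by linarith)] at hN
  have : (N : ℝ) ≤ n := by exact_mod_cast hn
  nlinarith

theorem exists_card_colours_le {s k : ℕ} (hs : 3 ≤ s) (hk : 3 ≤ k) :
    ∃ N : ℕ, ∀ n : ℕ, N ≤ n → ∀ (c : ℕ) (φ : Edge n s → Fin c), Function.Surjective φ →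
      (∀ vs es, IsRainbowPath φ vs es → es.length ≠ k) → (c : ℝ) ≤ rate s k * n := by
  -- The value of p depends on the colouring, but only those with p + 2 ≤ k matter, so one threshold
  -- serves them all.
  have hlen : ∀ p : ℕ, ∃ N : ℕ, p + 2 ≤ k → ∀ n : ℕ, N ≤ n → ∀ (c : ℕ) (φ : Edge n s → Fin c),
      Function.Surjective φ → (∀ vs es, IsRainbowPath φ vs es → es.length ≠ p + 2) →
      (∃ vs es, IsRainbowPath φ vs es ∧ es.length = p + 1) → (c : ℝ) ≤ rate s k * n := by
    intro p
    by_cases hpk : p + 2 ≤ k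
    swap
    · exact ⟨0, fun h => absurd h hpk⟩
    obtain ⟨N₁, hN₁⟩ := exists_forall_le_of_lt (choose_half_lt_rate hs hk hpk)
      (((p + 1) * 2 ^ (p + 2) + p + 2 ^ (2 * p + 3) + (p + 1 + 2 ^ (p + 2)) : ℕ) : ℝ)
    obtain ⟨N₂, hN₂⟩ : ∃ N₂ : ℕ, ∀ n : ℕ, N₂ ≤ n → p + 2 < n → ∀ (c : ℕ) (G : Finset (Edge n s)),
        c ≤ G.card + (p + 1 + 2 ^ (p + 2)) → ¬ HasPath (fun e : Edge n s => e.1) G p →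
        (c : ℝ) ≤ rate s k * n := by
      -- For p = 0 a single vertex is a path, so the Turán alternative cannot occur.
      rcases Nat.eq_zero_or_pos p with rfl | hp
      · refine ⟨0, fun n _ hn c G _ hG => absurd ?_ hG⟩
        exact ⟨[⟨0, by omega⟩], [], .single _, by simp, by simp, rfl, by simp⟩
      · obtain ⟨γ, hγ, hG⟩ := exists_turan_rate hs hp hpk
        obtain ⟨N₂, hN₂⟩ := exists_forall_le_of_lt hγ ((p + 1 + 2 ^ (p + 2) : ℕ) : ℝ)
        refine ⟨N₂, fun n hn _ c G hc hGp => ?_⟩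
        have h1 := hG n G hGp
        have h2 : (c : ℝ) ≤ G.card + ((p + 1 + 2 ^ (p + 2) : ℕ) : ℝ) := by exact_mod_cast hc
        linarith [hN₂ n hn]
    refine ⟨N₁ + N₂ + s + p + 3, fun _ n hn c φ hφ hno ⟨vs, es, hP, hlen⟩ => ?_⟩
    rcases exists_hypergraph_or_card_le hφ hs (by omega) (by omega) hno hP hlen with
      ⟨G, hc, hG⟩ | hc
    · exact hN₂ n (by omega) (by omega) c G hc hG
    · refine le_trans ?_ (hN₁ n (by omega))
      exact_mod_cast hc
  choose N hN using hlen
  refine ⟨(Finset.range k).sup N + s, fun n hn c φ hφ hno => ?_⟩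
  obtain ⟨p, hpk, hp, hP⟩ := exists_maximal_rainbow hs (by omega : s ≤ n) hno
  have : N p ≤ (Finset.range k).sup N := Finset.le_sup (Finset.mem_range.2 (by omega))
  exact hN p hpk n (by omega) c φ hφ hp hP

theorem exists_antiRamsey_le {s k : ℕ} (hs : 3 ≤ s) (hk : 3 ≤ k) :
    ∃ N : ℕ, ∀ n : ℕ, N ≤ n → (antiRamsey n s (bergePaths n s k) : ℝ) ≤ rate s k * n + 1 := by
  obtain ⟨N, hN⟩ := exists_card_colours_le hs hk
  refine ⟨N, fun n hn => ?_⟩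
  have h0 : 0 ≤ rate s k * n := mul_nonneg (rate_pos hs hk).le (Nat.cast_nonneg _)
  have hle : antiRamsey n s (bergePaths n s k) ≤ ⌊rate s k * n⌋₊ + 1 := by
    refine Nat.sInf_le ⟨by omega, fun φ hφ => ?_⟩
    by_contra! hcon
    have h1 := hN n hn _ φ hφ fun vs es h hlen => by
      obtain ⟨P, hP, hrain⟩ := h.exists_mem_bergePaths
      exact hcon P (hlen ▸ hP) hrain
    push_cast at h1
    linarith [Nat.lt_floor_add_one (rate s k * n)]
  calc (antiRamsey n s (bergePaths n s k) : ℝ) ≤ (⌊rate s k * n⌋₊ + 1 : ℕ) := by exact_mod_cast hle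
    _ ≤ rate s k * n + 1 := by
      push_cast
      linarith [Nat.floor_le h0]

theorem rate_mul_of_add_two_le {s k : ℕ} (hs : 3 ≤ s) (hk : s + 2 ≤ k) (n : ℕ) :
    rate s k * n = (n : ℝ) / ((k : ℝ) - 1) * (((k - 1 : ℕ).choose s : ℕ) : ℝ) := by
  have hs0 : (s : ℝ) ≠ 0 := by exact_mod_cast (by omega : s ≠ 0)
  have hk1 : ((k : ℝ) - 1) ≠ 0 := by
    have : (5 : ℝ) ≤ k := by exact_mod_cast (by omega : 5 ≤ k)
    linarith
  have h1 : ((k - 1).choose s : ℝ) * s = ((k : ℝ) - 1) * (k - 2).choose (s - 1) := by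
    have h2 := choose_mul_eq (s := s) (p := k - 1) (by omega) (by omega)
    have h3 : ((k - 1 : ℕ) : ℝ) = (k : ℝ) - 1 := by
      rw [Nat.cast_sub (by omega), Nat.cast_one]
    rw [← h3]
    exact_mod_cast h2
  rw [rate, if_neg (by omega)]
  field_simp
  linear_combination -(n : ℝ) * h1

end Upper

/-! ### The lower bounds in the stated form -/

section LowerRates

theorem le_antiRamsey_of_two_mul_lt {s k n : ℕ} (hs : 3 ≤ s) (hk : 2 * s + 1 < k) (hn : 2 * k ≤ n) :
    2 * (n : ℝ) / (k : ℝ) * (((k / 2 : ℕ).choose s : ℕ) : ℝ)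
      ≤ (antiRamsey n s (bergePaths n s k) : ℝ) := by
  -- This is the largest a with 2a + 2 ≤ k. Since s · C(k/2, s) = ⌊k/2⌋ · C(a, s - 1), the target is
  -- at most C(a, s - 1) n/s, and n ≤ s(n - a) leaves room.
  set a := k / 2 - 1 with ha
  have h1 := choose_mul_lt_antiRamsey (n := n) (s := s) (k := k) (a := a) (by omega) (by omega)
    (by omega)
  have h1' : (a.choose (s - 1) : ℝ) * (n - a) ≤ antiRamsey n s (bergePaths n s k) := by
    rw [← Nat.cast_sub (by omega)]
    exact_mod_cast h1.le
  refine le_trans ?_ h1'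
  have h2 : ((k / 2).choose s : ℝ) * s = (k / 2 : ℕ) * a.choose (s - 1) := by
    exact_mod_cast choose_mul_eq (s := s) (p := k / 2) (by omega) (by omega)
  have hk0 : (0 : ℝ) < k := by exact_mod_cast (by omega : 0 < k)
  have hs0 : (3 : ℝ) ≤ s := by exact_mod_cast hs
  have h3 : 2 * ((k / 2 : ℕ) : ℝ) ≤ k := by exact_mod_cast Nat.mul_div_le k 2
  have h4 : 2 * (a : ℝ) ≤ n := by exact_mod_cast (by omega : 2 * a ≤ n)
  have hn0 : (0 : ℝ) ≤ n := Nat.cast_nonneg _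
  set x : ℝ := (a.choose (s - 1) : ℝ) with hx
  have hx0 : 0 ≤ x := Nat.cast_nonneg _
  rw [div_mul_eq_mul_div, div_le_iff₀ hk0]
  refine le_of_mul_le_mul_right ?_ (by linarith : (0 : ℝ) < s)
  calc 2 * (n : ℝ) * (k / 2).choose s * s = (n * x) * (2 * ((k / 2 : ℕ) : ℝ)) := by
        linear_combination 2 * (n : ℝ) * h2
    _ ≤ (n * x) * k := mul_le_mul_of_nonneg_left h3 (by positivity)
    _ = x * k * n := by ring
    _ ≤ x * k * ((n - a) * s) := mul_le_mul_of_nonneg_left (by nlinarith) (by positivity)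
    _ = x * (n - a) * k * s := by ring

theorem le_antiRamsey_of_le_two_mul {s k n : ℕ} (hs : 3 ≤ s) (hk : s + 2 ≤ k)
    (hk' : k ≤ 2 * s + 1) (hn : s * s ≤ n) :
    (n : ℝ) / ((s : ℝ) + 1) * (((k - 2) / 2 : ℕ) : ℝ)
      ≤ (antiRamsey n s (bergePaths n s k) : ℝ) := by
  have hsn : s ≤ n := le_trans (Nat.le_mul_self s) hn
  have hn' : (s : ℝ) * s ≤ n := by exact_mod_cast hn
  have hs0 : (0 : ℝ) < (s : ℝ) + 1 := by positivity
  have hn0 : (0 : ℝ) ≤ n := Nat.cast_nonneg _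
  rw [div_mul_eq_mul_div, div_le_iff₀ hs0]
  -- Blocks would lose the remainder of n modulo s + 1, so sunflowers are used. For k ≥ s + 3 a core
  -- of s - 1 vertices gives about n edges; for k = s + 2 the core may have only s - 2 vertices, and
  -- about n/2 edges still exceed n⌊s/2⌋/(s + 1).
  rcases Nat.lt_or_ge (s + 2) k with h | h
  · have h1 := lt_antiRamsey_of_sunflower (n := n) (s := s) (k := k) (c := s - 1) (w := 1)
      (t := n - (s - 1)) le_rfl (by omega) (by omega) (by omega)
    have h2 : (n : ℝ) + 1 ≤ antiRamsey n s (bergePaths n s k) + s := by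
      exact_mod_cast (by omega : n + 1 ≤ antiRamsey n s (bergePaths n s k) + s)
    have h3 : (((k - 2) / 2 : ℕ) : ℝ) + 1 ≤ s := by
      exact_mod_cast (by omega : (k - 2) / 2 + 1 ≤ s)
    nlinarith
  · obtain rfl : k = s + 2 := by omega
    have h1 := lt_antiRamsey_of_sunflower (n := n) (s := s) (k := s + 2) (c := s - 2) (w := 2)
      (t := (n - (s - 2)) / 2) (by omega) (by omega) (by omega) (by omega)
    have h2 : (n : ℝ) + 1 ≤ 2 * antiRamsey n s (bergePaths n s (s + 2)) + s := by
      exact_mod_cast (by omega : n + 1 ≤ 2 * antiRamsey n s (bergePaths n s (s + 2)) + s)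
    have h3 : 2 * (((s + 2 - 2) / 2 : ℕ) : ℝ) ≤ s := by
      exact_mod_cast (by omega : 2 * ((s + 2 - 2) / 2) ≤ s)
    nlinarith

end LowerRates

end BergeAntiRamsey

/-- Here `k / 2`, `(k - 2) / 2` and `n / (s + 1)` are quotients of natural numbers, hence floors;
the subtractions do not truncate because `3 ≤ k`. All other divisions are real. -/
theorem theorem1p7 (s k : ℕ) (hs : 3 ≤ s) (hk : 3 ≤ k) :
    ∃ n₀ : ℕ, ∀ n : ℕ, n₀ ≤ n →
      (2 * s + 1 < k →
        2 * (n : ℝ) / (k : ℝ) * (((k / 2 : ℕ).choose s : ℕ) : ℝ)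
            ≤ (BergeAntiRamsey.antiRamsey n s (BergeAntiRamsey.bergePaths n s k) : ℝ) ∧
        (BergeAntiRamsey.antiRamsey n s (BergeAntiRamsey.bergePaths n s k) : ℝ)
            ≤ (n : ℝ) / ((k : ℝ) - 1) * (((k - 1 : ℕ).choose s : ℕ) : ℝ) + 1) ∧
      (s + 2 ≤ k → k ≤ 2 * s + 1 →
        (n : ℝ) / ((s : ℝ) + 1) * (((k - 2) / 2 : ℕ) : ℝ)
            ≤ (BergeAntiRamsey.antiRamsey n s (BergeAntiRamsey.bergePaths n s k) : ℝ) ∧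
        (BergeAntiRamsey.antiRamsey n s (BergeAntiRamsey.bergePaths n s k) : ℝ)
            ≤ (n : ℝ) / ((k : ℝ) - 1) * (((k - 1 : ℕ).choose s : ℕ) : ℝ) + 1) ∧
      (k ≤ s + 1 →
        ((n / (s + 1) : ℕ) : ℝ) * (((k - 2) / 2 : ℕ) : ℝ)
            ≤ (BergeAntiRamsey.antiRamsey n s (BergeAntiRamsey.bergePaths n s k) : ℝ) ∧
        (BergeAntiRamsey.antiRamsey n s (BergeAntiRamsey.bergePaths n s k) : ℝ)
            ≤ ((k : ℝ) - 2) * (n : ℝ) / ((s : ℝ) + 1) + 1) := by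
  obtain ⟨N, hN⟩ := BergeAntiRamsey.exists_antiRamsey_le hs hk
  refine ⟨N + 2 * k + s * s, fun n hn => ⟨fun h => ⟨?_, ?_⟩, fun h h' => ⟨?_, ?_⟩,
    fun h => ⟨?_, ?_⟩⟩⟩
  · exact BergeAntiRamsey.le_antiRamsey_of_two_mul_lt hs h (by omega)
  · rw [← BergeAntiRamsey.rate_mul_of_add_two_le hs (by omega)]
    exact hN n (by omega)
  · exact BergeAntiRamsey.le_antiRamsey_of_le_two_mul hs h h' (by omega)
  · rw [← BergeAntiRamsey.rate_mul_of_add_two_le hs h]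
    exact hN n (by omega)
  · exact_mod_cast (BergeAntiRamsey.blocks_mul_lt_antiRamsey (n := n) (s := s) (k := k)
      (t := (k - 2) / 2) (by omega) (by omega) (by omega)).le
  · have := hN n (by omega)
    rwa [BergeAntiRamsey.rate, if_pos h, div_mul_eq_mul_div] at this
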